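/- **Setting.** Let $u_1=(0,0)$, $u_2=(1,0)$, $u_3=\tfrac12(1,\sqrt3)$ and $\psi_i(x)=\tfrac12(x-u_i)+u_i$ for $i\in\{1,2,3\}$. The Sierpiński graphs $G_n$ ($n\ge 0$) have vertex sets $VG_0=\{u_1,u_2,u_3\}$, $VG_{n+1}=\bigcup_i\psi_i(VG_n)$ and edge sets $EG_0=\{\{u_1,u_2\},\{u_2,u_3\},\{u_3,u_1\}\}$, $EG_{n+1}=\bigcup_i\psi_i(EG_n)$. For a word $w=w_1\cdots w_k\in\{1,2,3\}^k$ put $\psi_w=\psi_{w_1}\circ\dots\circ\psi_{w_k}$ (the identity if $k=0$), and for a subgraph $H$ of $G_N$, $N\ge k$, let $\pi_w(H)=\psi_w^{-1}(H\cap\psi_w(G_{N-k}))$, a subgraph of $G_{N-k}$. Let $\mathcal T_n$ be the set of spanning trees of $G_n$; let $\mathcal S_n^i$ be the set of spanning forests of $G_n$ with exactly two components, one containing $u_i$ and the other containing the two other corners $u_j$, $j\neq i$; let $\mathcal R_n$ be the set of spanning forests of $G_n$ with exactly three components, each containing exactly one of $u_1,u_2,u_3$. Put $\mathcal Q_n=\mathcal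 T_n\cup\bigcup_i\mathcal S_n^i\cup\mathcal R_n$. Let $\mathcal T_0^i=\{c_i\}$, where $c_i$ is the spanning tree of the triangle $G_0$ consisting of the two edges at $u_i$, and for $n\ge1$ let $\mathcal T_n^i$ be the set of $t\in\mathcal T_n$ such that for each $j\ne i$ the path in $t$ from $u_i$ to $u_j$ is contained in $\psi_i(G_{n-1})\cup\psi_j(G_{n-1})$. Let $\tau_n=|\mathcal T_n^1|$, $\sigma_n=|\mathcal S_n^1|$, $\rho_n=|\mathcal R_n|$. The trace of $f\in\mathcal Q_1$ is the spanning subgraph of $G_0$ given by $\mathsf{Tr} f=c_i$ if $f\in\mathcal T_1^i$; $\mathsf{Tr} f$ has the single edge joining the two corners other than $u_i$ if $f\in\mathcal S_1^i$; $\mathsf{Tr} f$ has no edges if $f\in\mathcal R_1$. For $f\in\mathcal Q_{n+1}$, $\mathsf{Tr} f=\bigcup_{w\in\{1,2,3\}^n}\psi_w(\mathsf{Tr}\,\pi_w(f))$, a spanning subgraph of $G_n$. For $m\ge n$ let $\mathsf{Tr}^m_n$ be the $(m-n)$-fold iterate of $\mathsf{Tr}$, from level $m$ to level $n$. For sets $\mathcal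 A_n$ of spanning subgraphs of $G_n$ ($n\ge0$) let $\varprojlim\mathcal A_n$ be the set of sequences $(f_n)_{n\ge0}$ with $f_n\in\mathcal A_n$ and $\mathsf{Tr} f_{n+1}=f_n$ for all $n$, with the $\sigma$-algebra generated by the coordinates. Put $\mathcal T_\infty^i=\varprojlim\mathcal T_n^i$, $\mathcal S_\infty^i=\varprojlim\mathcal S_n^i$, $\mathcal R_\infty=\varprojlim\mathcal R_n$. **Lemma.** For all $n\ge0$ and $i\in\{1,2,3\}$: 1. $|\mathcal T_n^i|=\tau_n$ and $|\mathcal S_n^i|=\sigma_n$, and $\tau_n,\sigma_n,\rho_n$ are positive and finite. 2. $\mathsf{Tr}$ maps $\mathcal T_{n+1}^i$ into $\mathcal T_n^i$, $\mathcal S_{n+1}^i$ into $\mathcal S_n^i$ and $\mathcal R_{n+1}$ into $\mathcal R_n$, and pushes the uniform distribution on $\mathcal T_{n+1}^i$, $\mathcal S_{n+1}^i$, $\mathcal R_{n+1}$ forward to the uniform distribution on $\mathcal T_n^i$, $\mathcal S_n^i$, $\mathcal R_n$, respectively. 3. For $g\in\mathcal T_n^i$, $g\in\mathcal S_n^i$,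 $g\in\mathcal R_n$, the fibre $\{f\in\mathcal Q_{n+1}:\mathsf{Tr} f=g\}$ has size $\tau_{n+1}/\tau_n$, $\sigma_{n+1}/\sigma_n$, $\rho_{n+1}/\rho_n$, respectively. Moreover, there are probability measures $P_{T^i}$ on $\mathcal T_\infty^i$, $P_{S^i}$ on $\mathcal S_\infty^i$ ($i\in\{1,2,3\}$) and $P_R$ on $\mathcal R_\infty$ whose images under the $n$-th coordinate projection are, for every $n\ge0$, the uniform distributions on $\mathcal T_n^i$, $\mathcal S_n^i$ and $\mathcal R_n$, respectively. Let $$\Omega=\{1,2,3\}\times\prod_{i}\mathcal T_\infty^i\times\prod_i\mathcal S_\infty^i\times\mathcal R_\infty$$ with the probability measure $P$ that is the product of the uniform distribution on $\{1,2,3\}$ and of the measures $P_{T^i}$, $P_{S^i}$, $P_R$. Let $B$ be the first coordinate on $\Omega$, let $T_n^i,S_n^i,R_n$ be the $n$-th entries of the coordinates in $\mathcal T_\infty^i,\mathcal S_\infty^i,\mathcal R_\infty$, and put $T_n=T_n^B$. Then, for every $n$, $T_n$ is uniformly distributed on the set $\mathcal T_n$ of all spanning trees of $G_n$, $T_n^i$,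 $S_n^i$ and $R_n$ are uniformly distributed on $\mathcal T_n^i$, $\mathcal S_n^i$ and $\mathcal R_n$, and for all $m\ge n$, everywhere on $\Omega$, $T_n=\mathsf{Tr}^m_nT_m$, $T_n^i=\mathsf{Tr}^m_nT_m^i$, $S_n^i=\mathsf{Tr}^m_nS_m^i$ and $R_n=\mathsf{Tr}^m_nR_m$. -/

import Mathlib

noncomputable section

namespace Sierpinski

/-! ### Sierpinski graphs -/

/-- The corners `(0,0)`, `(1,0)`, `(1/2, √3/2)` of the plane triangle
(the indices `1, 2, 3` are written `0, 1, 2`). -/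
def u : Fin 3 → ℝ × ℝ := ![(0, 0), (1, 0), (1 / 2, √3 / 2)]

/-- The similitude with ratio `1/2` and fixed point `u i`. -/
def psi (i : Fin 3) (x : ℝ × ℝ) : ℝ × ℝ := (1 / 2 : ℝ) • (x - u i) + u i

/-- `ψ_w = ψ_{w 0} ∘ ⋯ ∘ ψ_{w (k-1)}` for a word `w` of length `k`; the identity for `k = 0`. -/
def psiWord : (k : ℕ) → (Fin k → Fin 3) → ℝ × ℝ → ℝ × ℝ
  | 0, _ => id
  | k + 1, w => psi (w 0) ∘ psiWord k (Fin.tail w)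

/-- The vertex set of the `n`-th Sierpinski graph. -/
def VG : ℕ → Set (ℝ × ℝ)
  | 0 => {u 0, u 1, u 2}
  | n + 1 => ⋃ i : Fin 3, psi i '' VG n

/-- The edge set of the `n`-th Sierpinski graph. -/
def EG : ℕ → Set (Sym2 (ℝ × ℝ))
  | 0 => {s(u 0, u 1), s(u 1, u 2), s(u 2, u 0)}
  | n + 1 => ⋃ i : Fin 3, Sym2.map (psi i) '' EG n

/-- The `n`-th Sierpinski graph, with vertex set `VG n` and edge set `EG n`. -/
def G (n : ℕ) : SimpleGraph (VG n) := (SimpleGraph.fromEdgeSet (EG n)).induce (VG n)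

theorem psi_injective (i : Fin 3) : Function.Injective (psi i) := by
  intro x y h
  have h2 : (1 / 2 : ℝ) • (x - u i) = (1 / 2 : ℝ) • (y - u i) := add_right_cancel h
  exact sub_left_injective (smul_right_injective _ (by norm_num : (1 / 2 : ℝ) ≠ 0) h2)

theorem psiWord_injective :
    ∀ (k : ℕ) (w : Fin k → Fin 3), Function.Injective (psiWord k w)
  | 0, _ => Function.injective_id
  | k + 1, w => (psi_injective (w 0)).comp (psiWord_injective k (Fin.tail w))

theorem psi_mem {n : ℕ} (i : Fin 3) {x : ℝ × ℝ} (hx : x ∈ VG n) : psi i x ∈ VG (n + 1) :=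
  Set.mem_iUnion.2 ⟨i, x, hx, rfl⟩

theorem psiWord_mem {m : ℕ} : ∀ {k N : ℕ} (_ : k + m = N) (w : Fin k → Fin 3) {x : ℝ × ℝ},
    x ∈ VG m → psiWord k w x ∈ VG N
  | 0, N, h, w, x, hx => by
      have h0 : m = N := by omega
      subst h0
      exact hx
  | k + 1, 0, h, _, _, _ => by omega
  | k + 1, N + 1, h, w, x, hx =>
      psi_mem (w 0) (psiWord_mem (by omega : k + m = N) (Fin.tail w) hx)

theorem u_mem : ∀ (n : ℕ) (i : Fin 3), u i ∈ VG n
  | 0, i => by fin_cases i <;> simp [VG]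
  | n + 1, i => by
      have h := psi_mem i (u_mem n i)
      have h2 : psi i (u i) = u i := by simp [psi]
      rwa [h2] at h

/-- The corner `u i` as a vertex of `G n`. -/
def corner (n : ℕ) (i : Fin 3) : VG n := ⟨u i, u_mem n i⟩

/-- `ψ_i` as a map from the vertices of `G n` to those of `G (n + 1)`. -/
def psiV {n : ℕ} (i : Fin 3) : VG n ↪ VG (n + 1) where
  toFun x := ⟨psi i x, psi_mem i x.2⟩
  inj' _ _ h := Subtype.ext (psi_injective i (congrArg Subtype.val h))

/-- `ψ_w`, for a word `w` of length `k`, as a map from the vertices of `G m` to those of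
`G N`, where `N = k + m`. -/
def psiWordV {k m N : ℕ} (h : k + m = N) (w : Fin k → Fin 3) : VG m ↪ VG N where
  toFun x := ⟨psiWord k w x, psiWord_mem h w x.2⟩
  inj' _ _ e := Subtype.ext (psiWord_injective k w (congrArg Subtype.val e))

/-- The restriction `π_w(H) = ψ_w⁻¹(H ∩ ψ_w(G m))` of a spanning subgraph `H` of `G N`,
where `w` has length `k` and `N = k + m`. -/
def restrict {k m N : ℕ} (h : k + m = N) (w : Fin k → Fin 3) (H : SimpleGraph (VG N)) :
    SimpleGraph (VG m) :=
  (H ⊓ (G m).map (psiWordV h w)).comap (psiWordV h w)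

/-! ### Spanning trees and forests

A subgraph of `G n` containing all vertices is a graph `H : SimpleGraph (VG n)` with `H ≤ G n`. -/

/-- The set of spanning trees of `G n`. -/
def Trees (n : ℕ) : Set (SimpleGraph (VG n)) := {t | t ≤ G n ∧ t.IsTree}

/-- The spanning tree of `G 0` with the two edges at the corner `u i`. -/
def cherry (i : Fin 3) : SimpleGraph (VG 0) :=
  SimpleGraph.fromEdgeSet {e | ∃ j, j ≠ i ∧ e = s(corner 0 i, corner 0 j)}

/-- The spanning forest of `G 0` whose only edge joins the two corners different from `u i`. -/
def opposite (i : Fin 3) : SimpleGraph (VG 0) :=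
  SimpleGraph.fromEdgeSet {e | ∃ j k, j ≠ i ∧ k ≠ i ∧ e = s(corner 0 j, corner 0 k)}

/-- The class `𝒯_n^i`. For `n ≥ 1` it consists of the spanning trees `t` in which, for all
`j ≠ i`, the (unique) path from `u i` to `u j` is contained in `ψ_i(G (n-1)) ∪ ψ_j(G (n-1))`
(that path has an edge, so it suffices to look at its edges). -/
def TClass : (n : ℕ) → Fin 3 → Set (SimpleGraph (VG n))
  | 0, i => {cherry i}
  | n + 1, i => {t | t ∈ Trees (n + 1) ∧
      ∀ j, j ≠ i → ∀ p : t.Walk (corner (n + 1) i) (corner (n + 1) j), p.IsPath →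
        ∀ e ∈ p.edges, e ∈ ((G n).map (psiV i) ⊔ (G n).map (psiV j)).edgeSet}

/-- The class `𝒮_n^i`: spanning forests with two components, one containing `u i` and the
other one containing the two other corners. -/
def SClass (n : ℕ) (i : Fin 3) : Set (SimpleGraph (VG n)) :=
  {f | f ≤ G n ∧ f.IsAcyclic ∧ Nat.card f.ConnectedComponent = 2 ∧
    ∃ C D : f.ConnectedComponent, C ≠ D ∧ f.connectedComponentMk (corner n i) = C ∧
      ∀ j, j ≠ i → f.connectedComponentMk (corner n j) = D}

/-- The class `ℛ_n`: spanning forests with three components, each containing exactly one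
corner. -/
def RClass (n : ℕ) : Set (SimpleGraph (VG n)) :=
  {f | f ≤ G n ∧ f.IsAcyclic ∧ Nat.card f.ConnectedComponent = 3 ∧
    ∀ C : f.ConnectedComponent, ∃! j : Fin 3, f.connectedComponentMk (corner n j) = C}

/-- The class `𝒬_n`, the union of all the others. -/
def QClass (n : ℕ) : Set (SimpleGraph (VG n)) :=
  Trees n ∪ (⋃ i, SClass n i) ∪ RClass n

def tau (n : ℕ) : ℕ := (TClass n 0).ncard

def sigma (n : ℕ) : ℕ := (SClass n 0).ncard

def rho (n : ℕ) : ℕ := (RClass n).ncard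

/-! ### The trace -/

/-- The trace of `f ∈ 𝒬_1`: it is `cherry i` on `𝒯_1^i`, `opposite i` on `𝒮_1^i`, and the
graph without edges on `ℛ_1` (these seven classes are disjoint). -/
def traceOne (f : SimpleGraph (VG 1)) : SimpleGraph (VG 0) :=
  (⨆ i : Fin 3, ⨆ _ : f ∈ TClass 1 i, cherry i) ⊔
    (⨆ i : Fin 3, ⨆ _ : f ∈ SClass 1 i, opposite i)

/-- The trace of `f ∈ 𝒬_{n+1}`: on each part of `G (n+1)` isomorphic to `G 1`, replace the
forest induced by `f` by its trace. -/
def trace {n : ℕ} (f : SimpleGraph (VG (n + 1))) : SimpleGraph (VG n) :=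
  ⨆ w : Fin n → Fin 3,
    (traceOne (restrict (rfl : n + 1 = n + 1) w f)).map (psiWordV (add_zero n) w)

/-- The iterated trace from level `n + k` to level `n`. -/
def traceIter (n : ℕ) : (k : ℕ) → SimpleGraph (VG (n + k)) → SimpleGraph (VG n)
  | 0, f => f
  | k + 1, f => traceIter n k (trace f)

/-! ### Projective limits and the joint probability space -/

/-- All sets of spanning subgraphs of the finite graph `G n` are measurable. -/
instance instMeasurableSpaceGraph (n : ℕ) : MeasurableSpace (SimpleGraph (VG n)) := ⊤

/-- The projective limit of the sets `A n` along the trace, as a set of sequences; as a type it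
carries the trace of the product σ-algebra. -/
def ProjLim (A : (n : ℕ) → Set (SimpleGraph (VG n))) : Set ((n : ℕ) → SimpleGraph (VG n)) :=
  {x | ∀ n, x n ∈ A n ∧ trace (x (n + 1)) = x n}

abbrev TLim (i : Fin 3) : Type := ProjLim (fun n => TClass n i)

abbrev SLim (i : Fin 3) : Type := ProjLim (fun n => SClass n i)

abbrev RLim : Type := ProjLim RClass

/-- `{1,2,3} × 𝒯_∞^1 × 𝒯_∞^2 × 𝒯_∞^3 × 𝒮_∞^1 × 𝒮_∞^2 × 𝒮_∞^3 × ℛ_∞`. -/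
abbrev Omega : Type := Fin 3 × ((i : Fin 3) → TLim i) × ((i : Fin 3) → SLim i) × RLim

/-- The product of the uniform distribution on `{1,2,3}` with the given measures. -/
def jointMeasure (PT : (i : Fin 3) → MeasureTheory.Measure (TLim i))
    (PS : (i : Fin 3) → MeasureTheory.Measure (SLim i)) (PR : MeasureTheory.Measure RLim) :
    MeasureTheory.Measure Omega :=
  (ProbabilityTheory.uniformOn (Set.univ : Set (Fin 3))).prod
    ((MeasureTheory.Measure.pi PT).prod ((MeasureTheory.Measure.pi PS).prod PR))

/-- The random forest `T_n^i`. -/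
def TRand (i : Fin 3) (n : ℕ) (ω : Omega) : SimpleGraph (VG n) := (ω.2.1 i).1 n

/-- The random forest `S_n^i`. -/
def SRand (i : Fin 3) (n : ℕ) (ω : Omega) : SimpleGraph (VG n) := (ω.2.2.1 i).1 n

/-- The random forest `R_n`. -/
def RRand (n : ℕ) (ω : Omega) : SimpleGraph (VG n) := ω.2.2.2.1 n

/-- The random tree `T_n = T_n^B`, where `B` is the first coordinate. -/
def TreeRand (n : ℕ) (ω : Omega) : SimpleGraph (VG n) := TRand ω.1 n ω

end Sierpinski

end

open Sierpinski MeasureTheory ProbabilityTheory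

noncomputable section

namespace Sierpinski

/-! ### Geometry of the cells -/

/-! A spanning forest of G_n in which every component contains a corner is classified by the
partition it induces on the three corners (`IsPat`). The five partitions give exactly 𝒯_n, the three
𝒮_n^i and ℛ_n, so 𝒬_n is the set of all such forests.

G_{n+1} consists of three edge-disjoint copies of G_n that meet pairwise in one junction, so a
subgraph is the same thing as the triple of its restrictions to the cells. Which corners and
junctions are connected depends only on the partitions in the cells. So does acyclicity, once the
restrictions are forests: a finite graph is a forest iff edges plus components equal vertices, edges
add over the cells, and the number of vertices is 3|VG_n| - 3. Cycles are therefore excluded by the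
single equation "classes of the whole + 3 = sum of the classes in the cells". Hence the pattern at
level n + 1 is governed by a decidable relation `Glue` on the patterns of the cells
(`isPat_succ_iff`).

The trace acts cell by cell (`part_trace`) and keeps patterns (`IsPat.trace`). It also keeps the
class 𝒯^i, which above level 0 can be read off the patterns in the cells. So the fibre over a forest
g is the product of the fibres over its restrictions. Over G_0 the fibres have 18, 30 or 50 elements
for patterns with 1, 2 or 3 classes, a geometric progression of ratio 5/3. By the class equation the
product of three such sizes is again a constant times (5/3)^(number of classes), so the fibre size
depends only on the level and the pattern (`ncard_fibre`).

Constant fibres give the cardinalities, the ratios and the transport of uniform distributions.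
Choosing at each level a uniform preimage of the current forest defines a Markov chain whose
marginals are uniform and whose law lives on the projective limit (`exists_measure_projLim`).
Finally, the spanning trees split into three classes of equal size, so a uniform index followed by a
uniform tree of that class is a uniform spanning tree. -/

/-- Barycentric coordinates with respect to the corners `u 0, u 1, u 2`. -/
def bary (k : Fin 3) (x : ℝ × ℝ) : ℝ :=
  ![1 - x.1 - x.2 / √3, x.1 - x.2 / √3, 2 * x.2 / √3] k

theorem bary_u (i k : Fin 3) : bary k (u i) = if k = i then 1 else 0 := by
  have h3 : √3 ≠ 0 := by positivity
  fin_cases i <;> fin_cases k <;> simp [bary, u] <;> field_simp <;> norm_num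

theorem bary_psi (i k : Fin 3) (x : ℝ × ℝ) :
    bary k (psi i x) = (bary k x + if k = i then 1 else 0) / 2 := by
  rw [← bary_u]
  fin_cases k <;> simp [bary, psi] <;> ring

theorem bary_sum (x : ℝ × ℝ) : bary 0 x + bary 1 x + bary 2 x = 1 := by
  simp [bary]; ring

theorem eq_of_bary_eq {x y : ℝ × ℝ} (h : ∀ k, bary k x = bary k y) : x = y := by
  have h3 : √3 ≠ 0 := by positivity
  have h1 := h 1
  have h2 := h 2
  simp only [bary, Matrix.cons_val] at h1 h2
  have e2 : x.2 = y.2 := by field_simp at h2; linarith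
  rw [e2] at h1
  exact Prod.ext (by linarith) e2

theorem bary_nonneg {n : ℕ} {x : ℝ × ℝ} (hx : x ∈ VG n) (k : Fin 3) : 0 ≤ bary k x := by
  induction n generalizing x with
  | zero =>
    simp only [VG, Set.mem_insert_iff, Set.mem_singleton_iff] at hx
    rcases hx with rfl | rfl | rfl <;> rw [bary_u] <;> split_ifs <;> norm_num
  | succ n ih =>
    obtain ⟨i, y, hy, rfl⟩ := Set.mem_iUnion.1 hx
    rw [bary_psi]
    have := ih hy
    split_ifs <;> linarith

theorem psi_u_comm (i j : Fin 3) : psi i (u j) = psi j (u i) := by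
  apply eq_of_bary_eq
  intro k
  simp only [bary_psi, bary_u]
  ring

theorem eq_u_of_bary_eq_one {n : ℕ} {x : ℝ × ℝ} (hx : x ∈ VG n) {j : Fin 3} (h : bary j x = 1) :
    x = u j := by
  apply eq_of_bary_eq
  intro k
  have h0 := bary_nonneg hx 0
  have h1 := bary_nonneg hx 1
  have h2 := bary_nonneg hx 2
  have hs := bary_sum x
  rw [bary_u]
  fin_cases j <;> fin_cases k <;> simp at h ⊢ <;> linarith

/-- Distinct cells meet in a single junction. -/
theorem psi_eq_psi_iff {n : ℕ} {i j : Fin 3} (hij : i ≠ j) {x y : ℝ × ℝ} (hx : x ∈ VG n)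
    (hy : y ∈ VG n) : psi i x = psi j y ↔ x = u j ∧ y = u i := by
  refine ⟨fun h => ?_, ?_⟩
  -- The i-th and j-th coordinates give `bary i y = bary i x + 1` and `bary j x = bary j y + 1`. As
  -- all coordinates lie in [0, 1], both left sides equal 1.
  · have hi := congrArg (bary i) h
    have hj := congrArg (bary j) h
    simp only [bary_psi, if_true, if_neg hij, if_neg hij.symm, add_zero] at hi hj
    have key : ∀ z ∈ VG n, ∀ k, bary k z ≤ 1 := by
      intro z hz k
      have h0 := bary_nonneg hz 0
      have h1 := bary_nonneg hz 1
      have h2 := bary_nonneg hz 2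
      have hs := bary_sum z
      fin_cases k <;> simp <;> linarith
    refine ⟨eq_u_of_bary_eq_one hx ?_, eq_u_of_bary_eq_one hy ?_⟩
    · have := key x hx j
      have := bary_nonneg hy j
      linarith
    · have := key y hy i
      have := bary_nonneg hx i
      linarith
  · rintro ⟨rfl, rfl⟩
    exact psi_u_comm i j

theorem VG_finite (n : ℕ) : (VG n).Finite := by
  induction n with
  | zero => simp [VG]
  | succ n ih => exact Set.finite_iUnion fun i => ih.image _

instance (n : ℕ) : Finite (VG n) := (VG_finite n).to_subtype

theorem u_injective : Function.Injective u := by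
  intro i j h
  by_contra hij
  have := congrArg (bary i) h
  simp [bary_u, hij] at this

theorem corner_injective (n : ℕ) : Function.Injective (corner n) := fun _ _ h =>
  u_injective (congrArg Subtype.val h)

theorem corner_zero_surjective : Function.Surjective (corner 0) := by
  rintro ⟨x, hx⟩
  have hx' := hx
  simp only [VG, Set.mem_insert_iff, Set.mem_singleton_iff] at hx'
  rcases hx' with rfl | rfl | rfl
  exacts [⟨0, rfl⟩, ⟨1, rfl⟩, ⟨2, rfl⟩]

theorem exists_psiV_eq {n : ℕ} (x : VG (n + 1)) : ∃ i y, psiV i y = x := by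
  obtain ⟨i, y, hy, h⟩ := Set.mem_iUnion.1 x.2
  exact ⟨i, ⟨y, hy⟩, Subtype.ext h⟩

theorem psiV_eq_psiV_iff {n : ℕ} {i j : Fin 3} (hij : i ≠ j) {x y : VG n} :
    psiV i x = psiV j y ↔ x = corner n j ∧ y = corner n i := by
  rw [Subtype.ext_iff, Subtype.ext_iff, Subtype.ext_iff]
  exact psi_eq_psi_iff hij x.2 y.2

theorem psiV_corner_comm (n : ℕ) (i j : Fin 3) :
    psiV i (corner n j) = psiV j (corner n i) := Subtype.ext (psi_u_comm i j)

theorem psiV_corner_self (n : ℕ) (i : Fin 3) : psiV i (corner n i) = corner (n + 1) i :=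
  Subtype.ext (by simp [psiV, corner, psi])

theorem G_adj {n : ℕ} {x y : VG n} :
    (G n).Adj x y ↔ s((x : ℝ × ℝ), (y : ℝ × ℝ)) ∈ EG n ∧ x ≠ y := by
  simp [G, Subtype.ext_iff]

theorem EG_mem_VG {n : ℕ} {x y : ℝ × ℝ} (h : s(x, y) ∈ EG n) : x ∈ VG n ∧ y ∈ VG n := by
  induction n generalizing x y with
  | zero =>
    simp only [EG, Set.mem_insert_iff, Set.mem_singleton_iff, Sym2.eq_iff] at h
    rcases h with (⟨rfl, rfl⟩ | ⟨rfl, rfl⟩) | (⟨rfl, rfl⟩ | ⟨rfl, rfl⟩) | (⟨rfl, rfl⟩ | ⟨rfl, rfl⟩) <;>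
      exact ⟨u_mem 0 _, u_mem 0 _⟩
  | succ n ih =>
    obtain ⟨i, e, he, h⟩ := Set.mem_iUnion.1 h
    induction e with
    | _ a b =>
      rw [Sym2.map_mk, Sym2.eq_iff] at h
      have := ih he
      rcases h with ⟨rfl, rfl⟩ | ⟨rfl, rfl⟩
      exacts [⟨psi_mem i this.1, psi_mem i this.2⟩, ⟨psi_mem i this.2, psi_mem i this.1⟩]

theorem G_succ (n : ℕ) : G (n + 1) = ⨆ i, (G n).map (psiV i) := by
  ext x y
  simp only [SimpleGraph.iSup_adj, SimpleGraph.map_adj, G_adj]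
  constructor
  · rintro ⟨h, hxy⟩
    obtain ⟨i, e, he, h⟩ := Set.mem_iUnion.1 h
    induction e with
    | _ a b =>
      have hab := EG_mem_VG he
      rw [Sym2.map_mk, Sym2.eq_iff] at h
      rcases h with ⟨h1, h2⟩ | ⟨h1, h2⟩
      · refine ⟨i, ⟨a, hab.1⟩, ⟨b, hab.2⟩, ⟨he, ?_⟩, Subtype.ext h1, Subtype.ext h2⟩
        rintro h
        rw [Subtype.mk_eq_mk] at h
        subst h
        exact hxy (Subtype.ext (h1.symm.trans h2))
      · refine ⟨i, ⟨b, hab.2⟩, ⟨a, hab.1⟩, ⟨Sym2.eq_swap ▸ he, ?_⟩, Subtype.ext h2, Subtype.ext h1⟩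
        rintro h
        rw [Subtype.mk_eq_mk] at h
        subst h
        exact hxy (Subtype.ext (h2.symm.trans h1))
  · rintro ⟨i, a, b, ⟨he, hab⟩, rfl, rfl⟩
    exact ⟨Set.mem_iUnion.2 ⟨i, _, he, rfl⟩, (psiV i).injective.ne hab⟩

theorem G_zero : G 0 = ⊤ := by
  ext x y
  rw [G_adj, SimpleGraph.top_adj]
  refine ⟨fun h => h.2, fun h => ⟨?_, h⟩⟩
  obtain ⟨i, rfl⟩ := corner_zero_surjective x
  obtain ⟨j, rfl⟩ := corner_zero_surjective y
  have hij : i ≠ j := fun e => h (e ▸ rfl)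
  fin_cases i <;> fin_cases j <;> simp_all [EG, corner]

/-! ### Parts of a subgraph and gluing -/

/-- The restriction of a subgraph of `G (n + 1)` to the cell `ψ_i`. -/
def part {n : ℕ} (i : Fin 3) (H : SimpleGraph (VG (n + 1))) : SimpleGraph (VG n) :=
  H.comap (psiV i)

/-- The subgraph of `G (n + 1)` with prescribed restrictions to the three cells. -/
def glue {n : ℕ} (h : Fin 3 → SimpleGraph (VG n)) : SimpleGraph (VG (n + 1)) :=
  ⨆ i, (h i).map (psiV i)

variable {n : ℕ}

theorem glue_adj {h : Fin 3 → SimpleGraph (VG n)} {x y : VG (n + 1)} :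
    (glue h).Adj x y ↔ ∃ i a b, (h i).Adj a b ∧ psiV i a = x ∧ psiV i b = y := by
  simp only [glue, SimpleGraph.iSup_adj, SimpleGraph.map_adj]

theorem part_adj {i : Fin 3} {H : SimpleGraph (VG (n + 1))} {a b : VG n} :
    (part i H).Adj a b ↔ H.Adj (psiV i a) (psiV i b) := Iff.rfl

/-- Distinct cells share only one vertex, so the two ends of an edge cannot both lie in two of them.
This makes the cells edge-disjoint. -/
theorem cell_unique_of_ne {i j : Fin 3} {a b c d : VG n} (hab : a ≠ b)
    (h1 : psiV i a = psiV j c) (h2 : psiV i b = psiV j d) : i = j := by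
  by_contra hij
  exact hab ((((psiV_eq_psiV_iff hij).1 h1).1).trans ((psiV_eq_psiV_iff hij).1 h2).1.symm)

theorem part_glue (h : Fin 3 → SimpleGraph (VG n)) (i : Fin 3) : part i (glue h) = h i := by
  ext a b
  rw [part_adj, glue_adj]
  constructor
  · rintro ⟨j, c, d, hcd, h1, h2⟩
    obtain rfl := cell_unique_of_ne hcd.ne h1 h2
    rwa [← (psiV j).injective h1, ← (psiV j).injective h2]
  · exact fun hab => ⟨i, a, b, hab, rfl, rfl⟩

theorem G_succ_eq_glue (n : ℕ) : G (n + 1) = glue fun _ => G n := G_succ n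

theorem part_G (i : Fin 3) : part i (G (n + 1)) = G n := by
  rw [G_succ_eq_glue, part_glue]

theorem part_mono (i : Fin 3) {H K : SimpleGraph (VG (n + 1))} (h : H ≤ K) :
    part i H ≤ part i K := fun _ _ hab => h hab

theorem part_le {i : Fin 3} {H : SimpleGraph (VG (n + 1))} (hH : H ≤ G (n + 1)) :
    part i H ≤ G n := by
  rw [← part_G i]
  exact part_mono i hH

theorem glue_mono {h k : Fin 3 → SimpleGraph (VG n)} (H : ∀ i, h i ≤ k i) :
    glue h ≤ glue k :=
  iSup_mono fun i => SimpleGraph.map_monotone _ (H i)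

theorem glue_le {h : Fin 3 → SimpleGraph (VG n)} (H : ∀ i, h i ≤ G n) : glue h ≤ G (n + 1) := by
  rw [G_succ_eq_glue]
  exact glue_mono H

theorem glue_part {H : SimpleGraph (VG (n + 1))} (hH : H ≤ G (n + 1)) :
    glue (fun i => part i H) = H := by
  ext x y
  rw [glue_adj]
  constructor
  · rintro ⟨i, a, b, hab, rfl, rfl⟩
    exact hab
  · intro hxy
    have := hH hxy
    rw [G_succ_eq_glue, glue_adj] at this
    obtain ⟨i, a, b, -, rfl, rfl⟩ := this
    exact ⟨i, a, b, hxy, rfl, rfl⟩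

theorem ext_of_part_eq {H K : SimpleGraph (VG (n + 1))} (hH : H ≤ G (n + 1))
    (hK : K ≤ G (n + 1)) (h : ∀ i, part i H = part i K) : H = K := by
  rw [← glue_part hH, ← glue_part hK]
  exact congrArg glue (funext h)

theorem exists_part_adj {H : SimpleGraph (VG (n + 1))} (hH : H ≤ G (n + 1)) {x y : VG (n + 1)}
    (h : H.Adj x y) : ∃ i a b, (part i H).Adj a b ∧ psiV i a = x ∧ psiV i b = y := by
  rw [← glue_part hH] at h
  exact glue_adj.1 h

theorem reachable_of_part {i : Fin 3} {H : SimpleGraph (VG (n + 1))} {a b : VG n}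
    (h : (part i H).Reachable a b) : H.Reachable (psiV i a) (psiV i b) :=
  h.map ⟨psiV i, fun h => h⟩

/-! ### Connectivity between junctions -/

/-- The labels `(i, j)`, standing for the junction `ψ_i(u_j)`, that can be reached from the
corner `c` when `r i` describes the connectivity between the corners of the `i`-th cell. -/
inductive JReach (r : Fin 3 → Fin 3 → Fin 3 → Prop) (c : Fin 3) : Fin 3 → Fin 3 → Prop
  | start : JReach r c c c
  | move {i j k : Fin 3} : JReach r c i j → r i j k → JReach r c i k
  | swap {i j : Fin 3} : JReach r c i j → JReach r c j i

/-- Connectivity between the corners in a subgraph. -/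
def cornerRel (H : SimpleGraph (VG n)) (j k : Fin 3) : Prop :=
  H.Reachable (corner n j) (corner n k)

theorem reachable_of_JReach {H : SimpleGraph (VG (n + 1))} {c i j : Fin 3}
    (h : JReach (fun i => cornerRel (part i H)) c i j) :
    H.Reachable (corner (n + 1) c) (psiV i (corner n j)) := by
  induction h with
  | start => rw [psiV_corner_self]
  | move _ h ih => exact ih.trans (reachable_of_part h)
  | swap _ ih => rwa [psiV_corner_comm]

/-- A walk changes cells only at junctions, so along it one can keep track of a corner of the
current cell that is connected inside that cell to the current vertex. All representations `psiV i y
= x` are treated at once because a junction belongs to two cells. -/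
theorem JReach_of_reachable_aux {H : SimpleGraph (VG (n + 1))} (hH : H ≤ G (n + 1)) {c : Fin 3}
    {x : VG (n + 1)} (h : H.Reachable (corner (n + 1) c) x) (i : Fin 3) (y : VG n)
    (hy : psiV i y = x) :
    ∃ j, JReach (fun i => cornerRel (part i H)) c i j ∧ (part i H).Reachable (corner n j) y := by
  rw [SimpleGraph.reachable_iff_reflTransGen] at h
  induction h generalizing i y with
  | refl =>
    by_cases hic : i = c
    · subst hic
      rw [← psiV_corner_self] at hy
      exact ⟨i, .start, (psiV i).injective hy ▸ SimpleGraph.Reachable.refl _⟩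
    · rw [← psiV_corner_self] at hy
      obtain ⟨rfl, h⟩ := (psiV_eq_psiV_iff hic).1 hy
      exact absurd (corner_injective n h).symm hic
  | tail _ hxy ih =>
    obtain ⟨k, a, b, hab, rfl, rfl⟩ := exists_part_adj hH hxy
    obtain ⟨j, hj, hja⟩ := ih k a rfl
    have hjb := hja.trans hab.reachable
    by_cases hik : i = k
    · subst hik
      rw [(psiV i).injective hy]
      exact ⟨j, hj, hjb⟩
    -- The new vertex is the junction of the cells `i` and `k`; move to it inside `k`, then rename
    -- it as a junction of `i`.
    · obtain ⟨rfl, rfl⟩ := (psiV_eq_psiV_iff hik).1 hy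
      exact ⟨k, (hj.move hjb).swap, SimpleGraph.Reachable.refl _⟩

theorem reachable_junction_iff {H : SimpleGraph (VG (n + 1))} (hH : H ≤ G (n + 1))
    {c i j : Fin 3} : H.Reachable (corner (n + 1) c) (psiV i (corner n j)) ↔
      JReach (fun i => cornerRel (part i H)) c i j := by
  refine ⟨fun h => ?_, reachable_of_JReach⟩
  obtain ⟨k, hk, hkj⟩ := JReach_of_reachable_aux hH h i _ rfl
  exact hk.move hkj

theorem cornerRel_succ_iff {H : SimpleGraph (VG (n + 1))} (hH : H ≤ G (n + 1))
    {c j : Fin 3} : cornerRel H c j ↔ JReach (fun i => cornerRel (part i H)) c j j := by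
  rw [← reachable_junction_iff hH, psiV_corner_self]
  rfl

/-- Every vertex is connected to a corner. -/
def Anchored (H : SimpleGraph (VG n)) : Prop := ∀ x, ∃ j, H.Reachable (corner n j) x

theorem Anchored.part {H : SimpleGraph (VG (n + 1))} (hH : H ≤ G (n + 1)) (h : Anchored H)
    (i : Fin 3) : Anchored (part i H) := by
  intro y
  -- Following a walk that starts in the cell: either a corner of the cell has already been met, or
  -- the walk has stayed inside the cell.
  have key : ∀ x, H.Reachable (psiV i y) x →
      (∃ j, (Sierpinski.part i H).Reachable (corner n j) y) ∨
        ∃ z, psiV i z = x ∧ (Sierpinski.part i H).Reachable y z := by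
    intro x hx
    rw [SimpleGraph.reachable_iff_reflTransGen] at hx
    induction hx with
    | refl => exact .inr ⟨y, rfl, SimpleGraph.Reachable.refl _⟩
    | tail _ hxy ih =>
      obtain ih | ⟨z, hz, hyz⟩ := ih
      · exact .inl ih
      · obtain ⟨k, a, b, hab, rfl, rfl⟩ := exists_part_adj hH hxy
        by_cases hik : i = k
        · subst hik
          rw [(psiV i).injective hz] at hyz
          exact .inr ⟨b, rfl, hyz.trans hab.reachable⟩
        · obtain ⟨rfl, -⟩ := (psiV_eq_psiV_iff hik).1 hz
          exact .inl ⟨k, hyz.symm⟩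
  obtain ⟨c, hc⟩ := h (psiV i y)
  obtain h | ⟨z, hz, hyz⟩ := key _ hc.symm
  · exact h
  · rw [← psiV_corner_self] at hz
    by_cases hic : i = c
    · subst hic
      rw [(psiV i).injective hz] at hyz
      exact ⟨i, hyz.symm⟩
    · obtain ⟨rfl, -⟩ := (psiV_eq_psiV_iff hic).1 hz
      exact ⟨c, hyz.symm⟩

/-- Once the parts are anchored only the junctions remain to be connected to the outer corners, and
this depends on the corner relations of the parts alone. -/
theorem anchored_succ_iff {H : SimpleGraph (VG (n + 1))} (hH : H ≤ G (n + 1)) :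
    Anchored H ↔ (∀ i, Anchored (part i H)) ∧
      ∀ i j, ∃ c, JReach (fun i => cornerRel (part i H)) c i j := by
  constructor
  · refine fun h => ⟨h.part hH, fun i j => ?_⟩
    obtain ⟨c, hc⟩ := h (psiV i (corner n j))
    exact ⟨c, (reachable_junction_iff hH).1 hc⟩
  · rintro ⟨h1, h2⟩ x
    obtain ⟨i, y, rfl⟩ := exists_psiV_eq x
    obtain ⟨j, hj⟩ := h1 i y
    obtain ⟨c, hc⟩ := h2 i j
    exact ⟨c, ((reachable_junction_iff hH).2 hc).trans (reachable_of_part hj)⟩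

/-! ### Counting edges, components and vertices -/

/-- The edges of an edge-disjoint union. -/
theorem card_edgeSet_eq_sum {ι W : Type*} [Fintype ι] {V : ι → Type*} [∀ i, Finite (V i)]
    (f : ∀ i, V i → W) (hf : ∀ i, Function.Injective (f i)) (h : ∀ i, SimpleGraph (V i))
    (H : SimpleGraph W)
    (hadj : ∀ x y, H.Adj x y ↔ ∃ i a b, (h i).Adj a b ∧ f i a = x ∧ f i b = y)
    (huniq : ∀ i j a b c d, (h i).Adj a b → (h j).Adj c d → f i a = f j c → f i b = f j d →
      i = j) :
    Nat.card H.edgeSet = ∑ i, Nat.card (h i).edgeSet := by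
  have hmem : ∀ i, ∀ e ∈ (h i).edgeSet, Sym2.map (f i) e ∈ H.edgeSet := by
    intro i e he
    induction e with
    | _ a b => exact (hadj _ _).2 ⟨i, a, b, he, rfl, rfl⟩
  rw [← Nat.card_sigma]
  refine (Nat.card_congr (Equiv.ofBijective
    (fun p : Σ i, (h i).edgeSet => (⟨Sym2.map (f p.1) p.2.1, hmem _ _ p.2.2⟩ : H.edgeSet))
    ⟨?_, ?_⟩)).symm
  · rintro ⟨i, e, he⟩ ⟨j, e', he'⟩ heq
    have heq := congrArg Subtype.val heq
    dsimp only at heq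
    have hij : i = j := by
      induction e with
      | _ a b =>
        induction e' with
        | _ c d =>
          rw [Sym2.map_mk, Sym2.map_mk, Sym2.eq_iff] at heq
          rcases heq with ⟨h1, h2⟩ | ⟨h1, h2⟩
          · exact huniq i j a b c d he he' h1 h2
          · exact huniq i j a b d c he (SimpleGraph.Adj.symm he') h1 h2
    subst hij
    obtain rfl := Sym2.map.injective (hf i) heq
    rfl
  · rintro ⟨e, he⟩
    induction e with
    | _ x y =>
      obtain ⟨i, a, b, hab, rfl, rfl⟩ := (hadj x y).1 he
      exact ⟨⟨i, s(a, b), hab⟩, rfl⟩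

/-- Sum the identity |E| + 1 = |V| for trees over the components. -/
theorem card_edgeSet_add_card_connectedComponent {V : Type*} [Finite V] {H : SimpleGraph V}
    (hH : H.IsAcyclic) : Nat.card H.edgeSet + Nat.card H.ConnectedComponent = Nat.card V := by
  have := Fintype.ofFinite H.ConnectedComponent
  have hE : Nat.card H.edgeSet =
      ∑ C : H.ConnectedComponent, Nat.card C.toSimpleGraph.edgeSet := by
    refine card_edgeSet_eq_sum (V := fun C : H.ConnectedComponent => C) (fun _ x => x.1)
      (fun _ => Subtype.val_injective) (fun C => C.toSimpleGraph) H ?_ ?_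
    · intro x y
      constructor
      · intro hxy
        refine ⟨H.connectedComponentMk x, ⟨x, rfl⟩, ⟨y, ?_⟩, hxy, rfl, rfl⟩
        exact (SimpleGraph.ConnectedComponent.sound hxy.reachable).symm
      · rintro ⟨C, a, b, hab, rfl, rfl⟩
        exact hab
    · rintro C D ⟨a, rfl⟩ b ⟨c, rfl⟩ d - - h1 -
      dsimp only at h1
      rw [h1]
  have hV : Nat.card V = ∑ C : H.ConnectedComponent, Nat.card C := by
    rw [← Nat.card_sigma]
    exact Nat.card_congr (Equiv.sigmaFiberEquiv H.connectedComponentMk).symm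
  rw [hE, hV, Nat.card_eq_fintype_card (α := H.ConnectedComponent), Fintype.card,
    Finset.card_eq_sum_ones, ← Finset.sum_add_distrib]
  exact Finset.sum_congr rfl fun C _ =>
    (SimpleGraph.isTree_iff_connected_and_card.1 (hH.isTree_connectedComponent C)).2

/-- A finite graph is a forest if and only if the numbers of its edges and components add up to
the number of its vertices. -/
theorem isAcyclic_iff_card {V : Type*} [Finite V] {H : SimpleGraph V} :
    H.IsAcyclic ↔
      Nat.card H.edgeSet + Nat.card H.ConnectedComponent = Nat.card V := by
  refine ⟨card_edgeSet_add_card_connectedComponent, fun h => ?_⟩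
  -- A maximal forest `F` in `H` has the same components, so the count leaves no room for further
  -- edges of `H`.
  obtain ⟨F, hle, hF, hr⟩ := H.exists_isAcyclic_reachable_eq_le
  have hc := card_edgeSet_add_card_connectedComponent hF
  have hcc : Nat.card F.ConnectedComponent = Nat.card H.ConnectedComponent := by
    refine Nat.card_congr (Quot.congr (Equiv.refl V) fun a b => ?_)
    rw [hr]
    rfl
  have hE : F.edgeSet = H.edgeSet := by
    refine Set.eq_of_subset_of_ncard_le (SimpleGraph.edgeSet_mono hle) ?_ (Set.toFinite _)
    rw [← Nat.card_coe_set_eq, ← Nat.card_coe_set_eq]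
    omega
  rwa [← SimpleGraph.edgeSet_inj.1 hE]

theorem card_edgeSet_succ {H : SimpleGraph (VG (n + 1))} (hH : H ≤ G (n + 1)) :
    Nat.card H.edgeSet = ∑ i, Nat.card (part i H).edgeSet := by
  refine card_edgeSet_eq_sum (fun i => psiV i) (fun i => (psiV i).injective) _ H ?_ ?_
  · exact fun x y => ⟨exists_part_adj hH, by rintro ⟨i, a, b, hab, rfl, rfl⟩; exact hab⟩
  · exact fun i j a b c d hab _ h1 h2 => cell_unique_of_ne hab.ne h1 h2

/-- Inclusion-exclusion: the cells meet pairwise in one junction, and the three junctions are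
distinct. -/
theorem card_VG_succ (n : ℕ) : Nat.card (VG (n + 1)) + 3 = 3 * Nat.card (VG n) := by
  have hU : (Set.univ : Set (VG (n + 1))) =
      Set.range (psiV 0) ∪ Set.range (psiV 1) ∪ Set.range (psiV 2) := by
    ext x
    obtain ⟨i, y, rfl⟩ := exists_psiV_eq x
    fin_cases i <;> simp
  have hR : ∀ i : Fin 3, (Set.range (psiV (n := n) i)).ncard = Nat.card (VG n) := fun i => by
    rw [← Set.image_univ, Set.ncard_image_of_injective _ (psiV i).injective, Set.ncard_univ]
  have hI : ∀ i j : Fin 3, i ≠ j →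
      Set.range (psiV (n := n) i) ∩ Set.range (psiV j) = {psiV i (corner n j)} := by
    intro i j hij
    ext x
    constructor
    · rintro ⟨⟨a, rfl⟩, b, hb⟩
      rw [((psiV_eq_psiV_iff hij).1 hb.symm).1]
      rfl
    · rintro rfl
      exact ⟨⟨_, rfl⟩, _, psiV_corner_comm n j i⟩
  have h1 := Set.ncard_union_add_ncard_inter (Set.range (psiV (n := n) 0)) (Set.range (psiV 1))
  have h2 := Set.ncard_union_add_ncard_inter
    (Set.range (psiV (n := n) 0) ∪ Set.range (psiV 1)) (Set.range (psiV 2))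
  rw [Set.union_inter_distrib_right, hI 0 2 (by decide), hI 1 2 (by decide), ← hU,
    Set.ncard_univ, hR, Set.singleton_union, Set.ncard_pair ?_] at h2
  · rw [hI 0 1 (by decide), hR, hR, Set.ncard_singleton] at h1
    omega
  · rw [Ne, psiV_eq_psiV_iff (by decide)]
    exact fun h => absurd (corner_injective n h.1) (by decide)

/-! ### Connectivity patterns -/

/-- The partitions of the set of corners: all corners together (`T`), the corner `i` separated
from the two others (`S i`), all corners separated (`R`). -/
inductive Pat
  | T
  | S (i : Fin 3)
  | R
  deriving DecidableEq, Fintype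

namespace Pat

/-- The equivalence relation of a pattern. -/
def Rel : Pat → Fin 3 → Fin 3 → Prop
  | T, _, _ => True
  | S i, j, k => j = i ↔ k = i
  | R, j, k => j = k

instance : ∀ (p : Pat) (j k : Fin 3), Decidable (p.Rel j k)
  | T, _, _ => inferInstanceAs (Decidable True)
  | S i, j, k => inferInstanceAs (Decidable (j = i ↔ k = i))
  | R, j, k => inferInstanceAs (Decidable (j = k))

/-- The number of classes of a pattern. -/
def ncl : Pat → ℕ
  | T => 1
  | S _ => 2
  | R => 3

theorem rel_equivalence (p : Pat) : Equivalence p.Rel := by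
  cases p <;> constructor <;> simp only [Rel] <;> grind

theorem eq_of_rel_iff {p q : Pat} (h : ∀ j k, p.Rel j k ↔ q.Rel j k) : p = q := by
  revert p q
  decide

theorem exists_rel_iff {r : Fin 3 → Fin 3 → Prop} (hr : Equivalence r) :
    ∃ p : Pat, ∀ j k, r j k ↔ p.Rel j k := by
  have d := hr.refl
  have s := @hr.symm
  have t := @hr.trans
  -- By reflexivity and symmetry only the three pairs matter. Of their eight truth assignments,
  -- transitivity excludes the three with exactly two pairs related.
  have key : ∀ p : Pat, (r 0 1 ↔ p.Rel 0 1) → (r 0 2 ↔ p.Rel 0 2) → (r 1 2 ↔ p.Rel 1 2) →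
      ∀ j k, r j k ↔ p.Rel j k := by
    intro p h1 h2 h3 j k
    have d' := p.rel_equivalence.refl
    have s' := fun x y => p.rel_equivalence.symm (x := x) (y := y)
    fin_cases j <;> fin_cases k <;> simp only [Fin.zero_eta, Fin.mk_one, Fin.reduceFinMk] <;> grind
  by_cases h01 : r 0 1 <;> by_cases h02 : r 0 2 <;> by_cases h12 : r 1 2
  · exact ⟨T, key T (by simp [Rel, *]) (by simp [Rel, *]) (by simp [Rel, *])⟩
  · exact absurd (t (s h01) h02) h12
  · exact absurd (t h01 h12) h02
  · exact ⟨S 2, key _ (by simp [Rel, *]) (by simp [Rel, *]) (by simp [Rel, *])⟩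
  · exact absurd (t h02 (s h12)) h01
  · exact ⟨S 1, key _ (by simp [Rel, *]) (by simp [Rel, *]) (by simp [Rel, *])⟩
  · exact ⟨S 0, key _ (by simp [Rel, *]) (by simp [Rel, *]) (by simp [Rel, *])⟩
  · exact ⟨R, key _ (by simp [Rel, *]) (by simp [Rel, *]) (by simp [Rel, *])⟩

theorem card_eq_ncl {C : Type*} {f : Fin 3 → C} (hf : Function.Surjective f) {p : Pat}
    (h : ∀ j k, f j = f k ↔ p.Rel j k) : Nat.card C = p.ncl := by
  rw [← Set.ncard_univ, ← hf.range_eq]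
  cases p with
  | T =>
    have : Set.range f = {f 0} := by
      ext x
      constructor
      · rintro ⟨j, rfl⟩
        exact (h j 0).2 trivial
      · rintro rfl
        exact ⟨0, rfl⟩
    rw [this, Set.ncard_singleton]
    rfl
  | S i =>
    have hi : ∀ i : Fin 3, i + 1 ≠ i := by decide
    have : Set.range f = {f i, f (i + 1)} := by
      ext x
      constructor
      · rintro ⟨j, rfl⟩
        by_cases hj : j = i
        · exact .inl (congrArg f hj)
        · exact .inr ((h _ _).2 (iff_of_false hj (hi i)))
      · rintro (rfl | rfl)
        exacts [⟨_, rfl⟩, ⟨_, rfl⟩]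
    rw [this, Set.ncard_pair]
    · rfl
    · rw [Ne, h]
      exact fun H => hi i (H.1 rfl)
  | R =>
    rw [← Set.image_univ, Set.ncard_image_of_injective _ fun j k hjk => (h j k).1 hjk,
      Set.ncard_univ, Nat.card_eq_fintype_card, Fintype.card_fin]
    rfl

end Pat

/-! ### Deciding reachability of junctions -/

/-- An explicit form of `JReach`: the last cell entered on a shortest way from the corner `c` to
the junction `(i, j)` is the `i`-th one. -/
def JStep (r : Fin 3 → Fin 3 → Fin 3 → Prop) (c i j : Fin 3) : Prop :=
  (i = c ∧ (r c c j ∨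
    (r c c (c + 1) ∧ r (c + 1) c (c + 2) ∧ r (c + 2) (c + 1) c ∧ r c (c + 2) j) ∨
    (r c c (c + 2) ∧ r (c + 2) c (c + 1) ∧ r (c + 1) (c + 2) c ∧ r c (c + 1) j))) ∨
  (i ≠ c ∧ ((r c c i ∧ r i c j) ∨
    -- Since 0 + 1 + 2 = 0 in `Fin 3`, `-(c + i)` is the third index when `i ≠ c`.
    (r c c (-(c + i)) ∧ r (-(c + i)) c i ∧ r i (-(c + i)) j)))

/-- An explicit form of `JReach`. -/
def JForm (r : Fin 3 → Fin 3 → Fin 3 → Prop) (c i j : Fin 3) : Prop :=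
  JStep r c i j ∨ JStep r c j i

instance (r : Fin 3 → Fin 3 → Fin 3 → Prop) [∀ i j k, Decidable (r i j k)] (c i j : Fin 3) :
    Decidable (JStep r c i j) := inferInstanceAs (Decidable (_ ∨ _))

instance (r : Fin 3 → Fin 3 → Fin 3 → Prop) [∀ i j k, Decidable (r i j k)] (c i j : Fin 3) :
    Decidable (JForm r c i j) := inferInstanceAs (Decidable (_ ∨ _))

theorem JReach_of_JStep {r : Fin 3 → Fin 3 → Fin 3 → Prop} {c i j : Fin 3} (h : JStep r c i j) :
    JReach r c i j := by
  rcases h with ⟨rfl, h | ⟨h1, h2, h3, h4⟩ | ⟨h1, h2, h3, h4⟩⟩ | ⟨-, ⟨h1, h2⟩ | ⟨h1, h2, h3⟩⟩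
  · exact JReach.start.move h
  · exact ((((JReach.start.move h1).swap.move h2).swap.move h3).swap).move h4
  · exact ((((JReach.start.move h1).swap.move h2).swap.move h3).swap).move h4
  · exact (JReach.start.move h1).swap.move h2
  · exact ((JReach.start.move h1).swap.move h2).swap.move h3

theorem JStep_trans {r : Fin 3 → Fin 3 → Fin 3 → Prop} (hr : ∀ i, Equivalence (r i))
    {c i j k : Fin 3} (h : JStep r c i j) (hjk : r i j k) : JStep r c i k := by
  have t := fun {x} => (hr i).trans (x := x) (y := j) (z := k)
  rcases h with ⟨rfl, h | ⟨h1, h2, h3, h4⟩ | ⟨h1, h2, h3, h4⟩⟩ | ⟨h, ⟨h1, h2⟩ | ⟨h1, h2, h3⟩⟩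
  · exact .inl ⟨rfl, .inl (t h hjk)⟩
  · exact .inl ⟨rfl, .inr (.inl ⟨h1, h2, h3, t h4 hjk⟩)⟩
  · exact .inl ⟨rfl, .inr (.inr ⟨h1, h2, h3, t h4 hjk⟩)⟩
  · exact .inr ⟨h, .inl ⟨h1, t h2 hjk⟩⟩
  · exact .inr ⟨h, .inr ⟨h1, h2, t h3 hjk⟩⟩

/-- Closure of the explicit form under a move that follows a swap: instead of shortening walks by
hand, all 125 triples of patterns are checked. -/
theorem JForm_of_JStep_swap_pat : ∀ (p : Pat × Pat × Pat) (c i j k : Fin 3),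
    JStep (fun i => (![p.1, p.2.1, p.2.2] i).Rel) c j i → (![p.1, p.2.1, p.2.2] i).Rel j k →
      JForm (fun i => (![p.1, p.2.1, p.2.2] i).Rel) c i k := by
  decide +kernel

theorem JForm_of_JStep_swap {r : Fin 3 → Fin 3 → Fin 3 → Prop} (hr : ∀ i, Equivalence (r i))
    {c i j k : Fin 3} (h : JStep r c j i) (hjk : r i j k) : JForm r c i k := by
  choose p hp using fun i => Pat.exists_rel_iff (hr i)
  obtain rfl : r = fun i => (![p 0, p 1, p 2] i).Rel := by
    ext i j k
    rw [hp]
    fin_cases i <;> rfl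
  exact JForm_of_JStep_swap_pat (p 0, p 1, p 2) c i j k h hjk

/-- The explicit form contains the start and is closed under moves and swaps. It makes the
inductively defined reachability decidable, so that gluing can be evaluated by computation. -/
theorem JReach_iff {r : Fin 3 → Fin 3 → Fin 3 → Prop} (hr : ∀ i, Equivalence (r i))
    {c i j : Fin 3} : JReach r c i j ↔ JForm r c i j := by
  constructor
  · intro h
    induction h with
    | start => exact .inl (.inl ⟨rfl, .inl ((hr c).refl c)⟩)
    | move _ hjk ih =>
      rcases ih with ih | ih
      · exact .inl (JStep_trans hr ih hjk)
      · exact JForm_of_JStep_swap hr ih hjk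
    | swap _ ih => exact ih.symm
  · rintro (h | h)
    · exact JReach_of_JStep h
    · exact (JReach_of_JStep h).swap

/-! ### Forests and the patterns of their parts -/

/-- `Glue p q` holds if forests of patterns `p i` in the cells form together a forest of
pattern `q`, each component of which contains a corner. -/
def Glue (p : Fin 3 → Pat) (q : Pat) : Prop :=
  (∀ c j, q.Rel c j ↔ JForm (fun i => (p i).Rel) c j j) ∧
    (∀ i j, ∃ c, JForm (fun i => (p i).Rel) c i j) ∧ q.ncl + 3 = ∑ i, (p i).ncl

instance (p : Fin 3 → Pat) (q : Pat) : Decidable (Glue p q) :=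
  inferInstanceAs (Decidable (_ ∧ _ ∧ _))

/-- Spanning forests of `G n` each component of which contains a corner, and which induce the
pattern `p` on the corners. -/
structure IsPat (H : SimpleGraph (VG n)) (p : Pat) : Prop where
  le : H ≤ G n
  isAcyclic : H.IsAcyclic
  anchored : Anchored H
  rel_iff : ∀ j k, cornerRel H j k ↔ p.Rel j k

theorem IsPat.unique {H : SimpleGraph (VG n)} {p q : Pat} (hp : IsPat H p) (hq : IsPat H q) :
    p = q :=
  Pat.eq_of_rel_iff fun j k => (hp.rel_iff j k).symm.trans (hq.rel_iff j k)

theorem cornerRel_equivalence (H : SimpleGraph (VG n)) : Equivalence (cornerRel H) :=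
  ⟨fun _ => SimpleGraph.Reachable.refl _, SimpleGraph.Reachable.symm, SimpleGraph.Reachable.trans⟩

theorem exists_isPat {H : SimpleGraph (VG n)} (h1 : H ≤ G n) (h2 : H.IsAcyclic)
    (h3 : Anchored H) : ∃ p, IsPat H p := by
  obtain ⟨p, hp⟩ := Pat.exists_rel_iff (cornerRel_equivalence H)
  exact ⟨p, h1, h2, h3, hp⟩

theorem Anchored.surjective {H : SimpleGraph (VG n)} (h : Anchored H) :
    Function.Surjective fun j => H.connectedComponentMk (corner n j) := by
  intro C
  induction C using SimpleGraph.ConnectedComponent.ind with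
  | _ x =>
    obtain ⟨j, hj⟩ := h x
    exact ⟨j, SimpleGraph.ConnectedComponent.sound hj⟩

theorem card_connectedComponent {H : SimpleGraph (VG n)} (h : Anchored H) {p : Pat}
    (hp : ∀ j k, cornerRel H j k ↔ p.Rel j k) : Nat.card H.ConnectedComponent = p.ncl :=
  Pat.card_eq_ncl h.surjective fun j k => SimpleGraph.ConnectedComponent.eq.trans (hp j k)

theorem cornerRel_succ_iff_JForm {H : SimpleGraph (VG (n + 1))} (hH : H ≤ G (n + 1))
    (c j : Fin 3) : cornerRel H c j ↔ JForm (fun i => cornerRel (part i H)) c j j := by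
  rw [cornerRel_succ_iff hH, JReach_iff fun i => cornerRel_equivalence _]

/-- The first two conditions of `Glue` express connectivity and anchoredness. Given acyclic parts,
the third is acyclicity: subtract the identities edges + components = vertices of the three cells
from that of the whole, and use that edges add and that the three copies of the vertex set count
three junctions twice. -/
theorem isPat_succ_iff {H : SimpleGraph (VG (n + 1))} (hH : H ≤ G (n + 1)) {q : Pat} :
    IsPat H q ↔ ∃ p : Fin 3 → Pat, (∀ i, IsPat (part i H) (p i)) ∧ Glue p q := by
  have hrel : ∀ {p : Fin 3 → Pat}, (∀ i j k, cornerRel (part i H) j k ↔ (p i).Rel j k) →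
      (fun i => cornerRel (part i H)) = fun i => (p i).Rel := fun h => by
    ext i j k
    exact h i j k
  have hV := card_VG_succ n
  have hE := card_edgeSet_succ hH
  rw [Fin.sum_univ_three] at hE
  constructor
  · rintro ⟨-, hac, han, hq⟩
    choose p hp using fun i => exists_isPat (part_le hH) (hac.of_comap (psiV i)) (han.part hH i)
    refine ⟨p, hp, fun c j => ?_, fun i j => ?_, ?_⟩
    · rw [← hrel fun i => (hp i).rel_iff, ← cornerRel_succ_iff_JForm hH, hq]
    · obtain ⟨c, hc⟩ := ((anchored_succ_iff hH).1 han).2 i j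
      rw [JReach_iff fun i => cornerRel_equivalence _, hrel fun i => (hp i).rel_iff] at hc
      exact ⟨c, hc⟩
    · have h := isAcyclic_iff_card.1 hac
      have hi := fun i => isAcyclic_iff_card.1 (hp i).isAcyclic
      simp only [fun i => card_connectedComponent (hp i).anchored (hp i).rel_iff] at hi
      rw [card_connectedComponent han hq] at h
      rw [Fin.sum_univ_three]
      have := hi 0
      have := hi 1
      have := hi 2
      omega
  · rintro ⟨p, hp, h1, h2, h3⟩
    have han : Anchored H := by
      refine (anchored_succ_iff hH).2 ⟨fun i => (hp i).anchored, fun i j => ?_⟩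
      obtain ⟨c, hc⟩ := h2 i j
      refine ⟨c, ?_⟩
      rwa [JReach_iff fun i => cornerRel_equivalence _, hrel fun i => (hp i).rel_iff]
    have hq : ∀ j k, cornerRel H j k ↔ q.Rel j k := fun j k => by
      rw [cornerRel_succ_iff_JForm hH, hrel fun i => (hp i).rel_iff, h1]
    refine ⟨hH, isAcyclic_iff_card.2 ?_, han, hq⟩
    rw [card_connectedComponent han hq]
    have hi := fun i => isAcyclic_iff_card.1 (hp i).isAcyclic
    simp only [fun i => card_connectedComponent (hp i).anchored (hp i).rel_iff] at hi
    rw [Fin.sum_univ_three] at h3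
    have := hi 0
    have := hi 1
    have := hi 2
    omega

/-! ### The classes of spanning forests in terms of patterns -/

theorem mem_Trees_iff {H : SimpleGraph (VG n)} : H ∈ Trees n ↔ IsPat H .T := by
  constructor
  · rintro ⟨h, ht⟩
    exact ⟨h, ht.isAcyclic, fun x => ⟨0, ht.connected.preconnected _ _⟩,
      fun j k => iff_of_true (ht.connected.preconnected _ _) trivial⟩
  · rintro ⟨h1, h2, h3, h4⟩
    have : Nonempty (VG n) := ⟨corner n 0⟩
    refine ⟨h1, ⟨⟨fun x y => ?_⟩, h2⟩⟩
    obtain ⟨j, hj⟩ := h3 x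
    obtain ⟨k, hk⟩ := h3 y
    exact hj.symm.trans (((h4 j k).2 trivial).trans hk)

/-- With only two components and a corner in each, anchoredness is automatic. Conversely,
anchoredness makes the pattern count all components. -/
theorem mem_SClass_iff {H : SimpleGraph (VG n)} {i : Fin 3} :
    H ∈ SClass n i ↔ IsPat H (.S i) := by
  have hi : i + 1 ≠ i := by revert i; decide
  constructor
  · rintro ⟨h1, h2, h3, C, D, hCD, hC, hD⟩
    have hall : ∀ E, E = C ∨ E = D := by
      have : Finite H.ConnectedComponent := Nat.finite_of_card_ne_zero (by omega)
      have h : ({C, D} : Set H.ConnectedComponent) = Set.univ := by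
        apply Set.eq_of_subset_of_ncard_le (Set.subset_univ _)
        rw [Set.ncard_univ, h3, Set.ncard_pair hCD]
      intro E
      have : E ∈ ({C, D} : Set H.ConnectedComponent) := h ▸ Set.mem_univ E
      exact this
    refine ⟨h1, h2, fun x => ?_, fun j k => ?_⟩
    · rcases hall (H.connectedComponentMk x) with h | h
      · exact ⟨i, SimpleGraph.ConnectedComponent.exact (hC.trans h.symm)⟩
      · exact ⟨i + 1, SimpleGraph.ConnectedComponent.exact ((hD _ hi).trans h.symm)⟩
    · rw [cornerRel, ← SimpleGraph.ConnectedComponent.eq, Pat.Rel]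
      by_cases hj : j = i <;> by_cases hk : k = i
      · simp [hj, hk]
      · simp [hj, hk, hC, hD k hk, hCD]
      · simp [hj, hk, hC, hD j hj, hCD.symm]
      · simp [hj, hk, hD j hj, hD k hk]
  · rintro ⟨h1, h2, h3, h4⟩
    refine ⟨h1, h2, card_connectedComponent h3 h4, H.connectedComponentMk (corner n i),
      H.connectedComponentMk (corner n (i + 1)), ?_, rfl, fun j hj => ?_⟩
    · rw [Ne, SimpleGraph.ConnectedComponent.eq]
      exact fun h => hi (((h4 _ _).1 h).1 rfl)
    · rw [SimpleGraph.ConnectedComponent.eq]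
      exact (h4 _ _).2 (iff_of_false hj hi)

theorem mem_RClass_iff {H : SimpleGraph (VG n)} : H ∈ RClass n ↔ IsPat H .R := by
  constructor
  · rintro ⟨h1, h2, -, h3⟩
    refine ⟨h1, h2, fun x => ?_, fun j k => ?_⟩
    · obtain ⟨j, hj, -⟩ := h3 (H.connectedComponentMk x)
      exact ⟨j, SimpleGraph.ConnectedComponent.exact hj⟩
    · refine ⟨fun h => ?_, ?_⟩
      · exact (h3 _).unique rfl (SimpleGraph.ConnectedComponent.sound h.symm)
      · rintro rfl
        exact SimpleGraph.Reachable.refl _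
  · rintro ⟨h1, h2, h3, h4⟩
    refine ⟨h1, h2, card_connectedComponent h3 h4, fun C => ?_⟩
    obtain ⟨j, hj⟩ := h3.surjective C
    exact ⟨j, hj, fun k hk =>
      (h4 _ _).1 (SimpleGraph.ConnectedComponent.exact (hk.trans hj.symm))⟩

theorem mem_QClass_iff {H : SimpleGraph (VG n)} : H ∈ QClass n ↔ ∃ p, IsPat H p := by
  simp only [QClass, Set.mem_union, Set.mem_iUnion, mem_Trees_iff, mem_SClass_iff, mem_RClass_iff]
  constructor
  · rintro ((h | ⟨i, h⟩) | h)
    exacts [⟨_, h⟩, ⟨_, h⟩, ⟨_, h⟩]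
  · rintro ⟨_ | i | _, h⟩
    exacts [.inl (.inl h), .inl (.inr ⟨i, h⟩), .inr h]

/-! ### The classes of spanning trees -/

theorem cornerRel_mono {H K : SimpleGraph (VG n)} (h : H ≤ K) {j k : Fin 3}
    (hjk : cornerRel H j k) : cornerRel K j k := SimpleGraph.Reachable.mono h hjk

/-- The cells `i` and `j` share a single junction, so a path from corner `i` to corner `j` inside
their union must pass through it and splits there into a path in each cell. -/
theorem mem_TClass_succ_iff {t : SimpleGraph (VG (n + 1))} {i : Fin 3} :
    t ∈ TClass (n + 1) i ↔ IsPat t .T ∧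
      ∀ j, j ≠ i → cornerRel (part i t) i j ∧ cornerRel (part j t) i j := by
  rw [← mem_Trees_iff]
  refine and_congr_right fun ht => forall₂_congr fun j hj => ?_
  set A := (G n).map (psiV i) ⊔ (G n).map (psiV j) with hA
  have hK : t ⊓ A ≤ G (n + 1) := inf_le_left.trans ht.1
  constructor
  · intro h
    obtain ⟨p, hp, -⟩ := ht.2.existsUnique_path (corner (n + 1) i) (corner (n + 1) j)
    have hr : cornerRel (t ⊓ A) i j := ⟨p.transfer (t ⊓ A) fun e he => by
      rw [SimpleGraph.edgeSet_inf]
      exact ⟨p.edges_subset_edgeSet he, h p hp e he⟩⟩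
    -- Intersecting with the two cells removes all edges of the third one, which rules out the
    -- detour through it.
    have hl : ∀ k, k ≠ i → k ≠ j → part k (t ⊓ A) = ⊥ := by
      intro k hki hkj
      ext a b
      simp only [part_adj, SimpleGraph.inf_adj, SimpleGraph.bot_adj, iff_false, hA,
        SimpleGraph.sup_adj, SimpleGraph.map_adj]
      rintro ⟨-, ⟨c, d, hcd, h1, h2⟩ | ⟨c, d, hcd, h1, h2⟩⟩
      · exact hki (cell_unique_of_ne hcd.ne h1 h2).symm
      · exact hkj (cell_unique_of_ne hcd.ne h1 h2).symm
    have key : ∀ i j : Fin 3, j ≠ i → -(i + j) ≠ i ∧ -(i + j) ≠ j := by decide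
    rw [cornerRel_succ_iff_JForm hK, JForm, or_self] at hr
    rcases hr with ⟨h, -⟩ | ⟨-, ⟨h1, h2⟩ | ⟨-, h2, -⟩⟩
    · exact absurd h hj
    · exact ⟨cornerRel_mono (part_mono i inf_le_left) h1,
        cornerRel_mono (part_mono j inf_le_left) h2⟩
    · rw [hl _ (key i j hj).1 (key i j hj).2, cornerRel, SimpleGraph.reachable_bot] at h2
      exact absurd (corner_injective n h2).symm hj
  · rintro ⟨h1, h2⟩ p hp e he
    have hle : ∀ k, k = i ∨ k = j → part k t ≤ part k (t ⊓ A) := by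
      intro k hk a b hab
      have hab' := part_le ht.1 hab
      refine ⟨hab, ?_⟩
      simp only [hA, SimpleGraph.sup_adj, SimpleGraph.map_adj]
      rcases hk with rfl | rfl
      exacts [.inl ⟨a, b, hab', rfl, rfl⟩, .inr ⟨a, b, hab', rfl, rfl⟩]
    have r1 := reachable_of_part (cornerRel_mono (hle i (.inl rfl)) h1)
    have r2 := reachable_of_part (cornerRel_mono (hle j (.inr rfl)) h2)
    rw [psiV_corner_self, psiV_corner_comm] at r1
    rw [psiV_corner_self] at r2
    obtain ⟨q, hq⟩ := (r1.trans r2).exists_isPath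
    -- Paths in a tree are unique, so `p` is the path `q` found inside the two cells.
    have : p = q.mapLe inf_le_left := congrArg Subtype.val
      ((ht.2.isAcyclic.subsingleton_path _ _).elim ⟨p, hp⟩ ⟨_, hq.mapLe inf_le_left⟩)
    rw [this, SimpleGraph.Walk.edges_mapLe_eq_edges] at he
    have := q.edges_subset_edgeSet he
    rw [SimpleGraph.edgeSet_inf] at this
    exact this.2

/-- The condition on the patterns in the cells that distinguishes the class `TClass (n + 1) i`. -/
def TGlue (i : Fin 3) (p : Fin 3 → Pat) : Prop := ∀ j, j ≠ i → (p i).Rel i j ∧ (p j).Rel i j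

instance (i : Fin 3) (p : Fin 3 → Pat) : Decidable (TGlue i p) :=
  inferInstanceAs (Decidable (∀ _, _))

theorem forall_pat_iff {P : (Fin 3 → Pat) → Prop} :
    (∀ p, P p) ↔ ∀ p : Pat × Pat × Pat, P ![p.1, p.2.1, p.2.2] := by
  refine ⟨fun h p => h _, fun h p => ?_⟩
  convert h (p 0, p 1, p 2) using 1
  ext i
  fin_cases i <;> rfl

/-- The class count forces two cells of pattern `T` and one cell `a` of pattern `S k`. Connectivity
requires `k ≠ a`, as otherwise the outer corner `a` would be isolated. The ring of cells is thus cut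
at one junction into a chain, and its middle cell, the one different from `a` and `k`, is the
required index. -/
theorem existsUnique_TGlue : ∀ p : Fin 3 → Pat, Glue p .T →
    ∃ i, TGlue i p ∧ ∀ j, TGlue j p → j = i := by
  rw [forall_pat_iff]
  decide +kernel

theorem mem_TClass_succ_iff_TGlue {t : SimpleGraph (VG (n + 1))} {i : Fin 3} {p : Fin 3 → Pat}
    (ht : IsPat t .T) (hp : ∀ i, IsPat (part i t) (p i)) :
    t ∈ TClass (n + 1) i ↔ TGlue i p := by
  rw [mem_TClass_succ_iff, and_iff_right ht]
  simp only [(hp _).rel_iff, TGlue]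

theorem existsUnique_mem_TClass_succ {t : SimpleGraph (VG (n + 1))} (ht : IsPat t .T) :
    ∃! i, t ∈ TClass (n + 1) i := by
  obtain ⟨p, hp, hg⟩ := (isPat_succ_iff ht.le).1 ht
  simp only [mem_TClass_succ_iff_TGlue ht hp]
  exact existsUnique_TGlue p hg

/-! ### The triangle -/

/-- Equal patterns mean equally many components, hence for forests equally many edges. -/
theorem eq_of_le_of_isPat {H K : SimpleGraph (VG n)} {p : Pat} (hH : IsPat H p)
    (hK : IsPat K p) (h : H ≤ K) : H = K := by
  have h1 := isAcyclic_iff_card.1 hH.isAcyclic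
  have h2 := isAcyclic_iff_card.1 hK.isAcyclic
  rw [card_connectedComponent hH.anchored hH.rel_iff] at h1
  rw [card_connectedComponent hK.anchored hK.rel_iff] at h2
  refine SimpleGraph.edgeSet_inj.1 (Set.eq_of_subset_of_ncard_le (SimpleGraph.edgeSet_mono h) ?_
    (Set.toFinite _))
  rw [← Nat.card_coe_set_eq, ← Nat.card_coe_set_eq]
  omega

theorem anchored_zero (H : SimpleGraph (VG 0)) : Anchored H := fun x => by
  obtain ⟨j, rfl⟩ := corner_zero_surjective x
  exact ⟨j, SimpleGraph.Reachable.refl _⟩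

theorem ext_corner {H K : SimpleGraph (VG 0)}
    (h : ∀ j k, H.Adj (corner 0 j) (corner 0 k) ↔ K.Adj (corner 0 j) (corner 0 k)) : H = K := by
  ext x y
  obtain ⟨j, rfl⟩ := corner_zero_surjective x
  obtain ⟨k, rfl⟩ := corner_zero_surjective y
  exact h j k

theorem le_corner {H K : SimpleGraph (VG 0)}
    (h : ∀ j k, H.Adj (corner 0 j) (corner 0 k) → K.Adj (corner 0 j) (corner 0 k)) : H ≤ K := by
  intro x y
  obtain ⟨j, rfl⟩ := corner_zero_surjective x
  obtain ⟨k, rfl⟩ := corner_zero_surjective y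
  exact h j k

theorem cherry_adj {i j k : Fin 3} :
    (cherry i).Adj (corner 0 j) (corner 0 k) ↔ j ≠ k ∧ (j = i ∨ k = i) := by
  simp only [cherry, SimpleGraph.fromEdgeSet_adj, Set.mem_ofPred_eq, Sym2.eq_iff,
    (corner_injective 0).eq_iff, (corner_injective 0).ne_iff]
  revert i j k
  decide

theorem opposite_adj {i j k : Fin 3} :
    (opposite i).Adj (corner 0 j) (corner 0 k) ↔ j ≠ k ∧ j ≠ i ∧ k ≠ i := by
  simp only [opposite, SimpleGraph.fromEdgeSet_adj, Set.mem_ofPred_eq, Sym2.eq_iff,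
    (corner_injective 0).eq_iff, (corner_injective 0).ne_iff]
  revert i j k
  decide

theorem cherry_injective : Function.Injective cherry := by
  intro i j h
  have : ∀ k l, (k ≠ l ∧ (k = i ∨ l = i)) ↔ (k ≠ l ∧ (k = j ∨ l = j)) := fun k l => by
    rw [← cherry_adj, ← cherry_adj, h]
  clear h
  revert i j
  decide

theorem isPat_cherry (i : Fin 3) : IsPat (cherry i) .T := by
  have : cherry i = SimpleGraph.starGraph (corner 0 i) := ext_corner fun j k => by
    rw [cherry_adj, SimpleGraph.starGraph_adj, (corner_injective 0).ne_iff,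
      (corner_injective 0).eq_iff, (corner_injective 0).eq_iff]
  rw [← mem_Trees_iff]
  exact ⟨G_zero ▸ le_top, this ▸ SimpleGraph.isTree_starGraph _⟩

theorem isPat_opposite (i : Fin 3) : IsPat (opposite i) (.S i) := by
  have hi : ∀ i j k : Fin 3, j ≠ k ∧ j ≠ i ∧ k ≠ i → j ≠ k ∧ (j = i + 1 ∨ k = i + 1) := by decide
  -- Acyclicity is inherited from the two-edge star at another corner, which contains the single
  -- edge.
  refine ⟨G_zero ▸ le_top, (isPat_cherry (i + 1)).isAcyclic.anti (le_corner fun j k h => ?_),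
    anchored_zero _, fun j k => ⟨fun h => ?_, fun h => ?_⟩⟩
  · rw [opposite_adj] at h
    exact cherry_adj.2 (hi i j k h)
  · have key : ∀ x, (opposite i).Reachable (corner 0 j) x → (j = i ↔ x = corner 0 i) := by
      intro x hx
      rw [SimpleGraph.reachable_iff_reflTransGen] at hx
      induction hx with
      | refl => rw [(corner_injective 0).eq_iff]
      | @tail x y _ hxy ih =>
        obtain ⟨a, rfl⟩ := corner_zero_surjective x
        obtain ⟨b, rfl⟩ := corner_zero_surjective y
        rw [opposite_adj] at hxy
        rw [ih, (corner_injective 0).eq_iff, (corner_injective 0).eq_iff]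
        exact iff_of_false hxy.2.1 hxy.2.2
    exact (key _ h).trans (corner_injective 0).eq_iff
  · by_cases hjk : j = k
    · subst hjk
      exact SimpleGraph.Reachable.refl _
    · have hj : j ≠ i := fun hj => hjk (hj.trans (h.1 hj).symm)
      exact (opposite_adj.2 ⟨hjk, hj, fun hk => hj (h.2 hk)⟩).reachable

theorem isPat_bot : IsPat (⊥ : SimpleGraph (VG 0)) .R := by
  refine ⟨bot_le, SimpleGraph.isAcyclic_bot, anchored_zero _, fun j k => ?_⟩
  rw [cornerRel, SimpleGraph.reachable_bot, (corner_injective 0).eq_iff]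
  rfl

/-- A tree cannot contain the whole triangle; it misses an edge, lies in the star at the opposite
corner, and equals it by counting edges. -/
theorem isPat_zero_T {H : SimpleGraph (VG 0)} (h : IsPat H .T) : ∃ i, H = cherry i := by
  by_cases hc : ∃ i j k : Fin 3, i ≠ j ∧ i ≠ k ∧ j ≠ k ∧ ¬H.Adj (corner 0 j) (corner 0 k)
  · obtain ⟨i, j, k, hij, hik, hjk, hH⟩ := hc
    refine ⟨i, eq_of_le_of_isPat h (isPat_cherry i) (le_corner fun a b hab => ?_)⟩
    have hab' := hab.symm
    have hne : a ≠ b := fun e => hab.ne (congrArg _ e)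
    rw [cherry_adj]
    refine ⟨hne, ?_⟩
    have key : ∀ i j k a b : Fin 3, i ≠ j → i ≠ k → j ≠ k → a ≠ b →
        (a = i ∨ b = i) ∨ (a = j ∧ b = k) ∨ (b = j ∧ a = k) := by decide
    rcases key i j k a b hij hik hjk hne with h | ⟨rfl, rfl⟩ | ⟨rfl, rfl⟩
    exacts [h, absurd hab hH, absurd hab' hH]
  · push Not at hc
    refine absurd ?_ (h.isAcyclic.cliqueFree (le_refl 3) {corner 0 0, corner 0 1, corner 0 2})
    rw [SimpleGraph.is3Clique_triple_iff]
    exact ⟨hc 2 0 1 (by decide) (by decide) (by decide),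
      hc 1 0 2 (by decide) (by decide) (by decide), hc 0 1 2 (by decide) (by decide) (by decide)⟩

theorem isPat_zero_S {H : SimpleGraph (VG 0)} {i : Fin 3} (h : IsPat H (.S i)) :
    H = opposite i := by
  refine eq_of_le_of_isPat h (isPat_opposite i) (le_corner fun j k hjk => ?_)
  have hne : j ≠ k := fun e => hjk.ne (congrArg _ e)
  have hr : j = i ↔ k = i := (h.rel_iff j k).1 hjk.reachable
  rw [opposite_adj]
  grind

theorem isPat_zero_R {H : SimpleGraph (VG 0)} (h : IsPat H .R) : H = ⊥ := by
  refine ext_corner fun j k => iff_of_false (fun hjk => ?_) (by simp)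
  exact hjk.ne (congrArg _ ((h.rel_iff j k).1 hjk.reachable))

theorem existsUnique_mem_TClass {t : SimpleGraph (VG n)} (ht : IsPat t .T) :
    ∃! i, t ∈ TClass n i := by
  cases n with
  | zero =>
    obtain ⟨i, rfl⟩ := isPat_zero_T ht
    exact ⟨i, rfl, fun j hj => (cherry_injective hj).symm⟩
  | succ n => exact existsUnique_mem_TClass_succ ht

theorem isPat_of_mem_TClass {t : SimpleGraph (VG n)} {i : Fin 3} (ht : t ∈ TClass n i) :
    IsPat t .T := by
  cases n with
  | zero => exact ht ▸ isPat_cherry i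
  | succ n => exact (mem_TClass_succ_iff.1 ht).1

/-! ### The trace -/

theorem traceOne_eq {f : SimpleGraph (VG 1)} {q : Pat} (hf : IsPat f q) :
    traceOne f = match q with
      | .T => ⨆ i, ⨆ _ : f ∈ TClass 1 i, cherry i
      | .S i => opposite i
      | .R => ⊥ := by
  have hT : ∀ i, f ∈ TClass 1 i → q = .T := fun i hi => hf.unique (isPat_of_mem_TClass hi)
  have hS : ∀ i, f ∈ SClass 1 i ↔ q = .S i := fun i => by
    rw [mem_SClass_iff]
    exact ⟨fun h => hf.unique h, fun h => h ▸ hf⟩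
  unfold traceOne
  cases q with
  | T => simp [hS]
  | S i =>
    have h1 : ∀ j, f ∉ TClass 1 j := fun j hj => by simpa using hT j hj
    simp only [hS, h1, Pat.S.injEq, iSup_false, iSup_bot, bot_sup_eq]
    exact iSup_iSup_eq_right
  | R =>
    have h1 : ∀ j, f ∉ TClass 1 j := fun j hj => by simpa using hT j hj
    simp [hS, h1]

theorem traceOne_of_mem_TClass {f : SimpleGraph (VG 1)} {i : Fin 3} (hf : f ∈ TClass 1 i) :
    traceOne f = cherry i := by
  have h := isPat_of_mem_TClass hf
  have : ∀ j, f ∈ TClass 1 j ↔ i = j := fun j =>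
    ⟨fun hj => (existsUnique_mem_TClass h).unique hf hj, fun e => e ▸ hf⟩
  rw [traceOne_eq h]
  simp only [this]
  exact iSup_iSup_eq_right

theorem isPat_traceOne {f : SimpleGraph (VG 1)} {q : Pat} (hf : IsPat f q) :
    IsPat (traceOne f) q := by
  cases q with
  | T =>
    obtain ⟨i, hi, -⟩ := existsUnique_mem_TClass hf
    rw [traceOne_of_mem_TClass hi]
    exact isPat_cherry i
  | S i =>
    rw [traceOne_eq hf]
    exact isPat_opposite i
  | R =>
    rw [traceOne_eq hf]
    exact isPat_bot

theorem restrict_adj {k m N : ℕ} {h : k + m = N} {w : Fin k → Fin 3} {H : SimpleGraph (VG N)}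
    {a b : VG m} : (restrict h w H).Adj a b ↔
      H.Adj (psiWordV h w a) (psiWordV h w b) ∧ (G m).Adj a b := by
  rw [restrict, SimpleGraph.comap_adj, SimpleGraph.inf_adj, SimpleGraph.map_adj_apply]

theorem psiWordV_cons {k m N : ℕ} (h : k + 1 + m = N + 1) (h' : k + m = N) (i : Fin 3)
    (w : Fin k → Fin 3) (x : VG m) :
    psiWordV h (Fin.cons i w : Fin (k + 1) → Fin 3) x = psiV i (psiWordV h' w x) := rfl

theorem restrict_cons {k m N : ℕ} (h : k + 1 + m = N + 1) (h' : k + m = N) (i : Fin 3)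
    (w : Fin k → Fin 3) (H : SimpleGraph (VG (N + 1))) :
    restrict h (Fin.cons i w : Fin (k + 1) → Fin 3) H = restrict h' w (part i H) := by
  ext a b
  rw [restrict_adj, restrict_adj, psiWordV_cons h h', psiWordV_cons h h', part_adj]

theorem trace_adj {f : SimpleGraph (VG (n + 1))} {x y : VG n} :
    (trace f).Adj x y ↔ ∃ w a b,
      (traceOne (restrict (rfl : n + 1 = n + 1) w f)).Adj a b ∧
        psiWordV (add_zero n) w a = x ∧ psiWordV (add_zero n) w b = y := by
  simp only [trace, SimpleGraph.iSup_adj, SimpleGraph.map_adj]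

theorem trace_zero {f : SimpleGraph (VG 1)} (hf : f ≤ G 1) :
    trace (n := 0) f = traceOne f := by
  have h1 : ∀ w : Fin 0 → Fin 3, restrict (rfl : 0 + 1 = 0 + 1) w f = f := fun w => by
    ext a b
    rw [restrict_adj]
    exact ⟨fun h => h.1, fun h => ⟨h, hf h⟩⟩
  ext x y
  simp only [trace_adj, h1]
  constructor
  · rintro ⟨w, a, b, hab, rfl, rfl⟩
    exact hab
  · exact fun h => ⟨Fin.elim0, x, y, h, rfl, rfl⟩

/-- Splitting off the first letter of the words shows that the trace acts in each cell separately;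
this drives all inductions on the level. -/
theorem trace_succ (f : SimpleGraph (VG (n + 1 + 1))) :
    trace f = glue fun i => trace (part i f) := by
  ext x y
  simp only [glue_adj, trace_adj]
  constructor
  · rintro ⟨w, a, b, hab, rfl, rfl⟩
    obtain ⟨i, w, rfl⟩ : ∃ i w', w = Fin.cons i w' := ⟨w 0, Fin.tail w, (Fin.cons_self_tail w).symm⟩
    rw [restrict_cons _ rfl] at hab
    exact ⟨i, _, _, ⟨w, a, b, hab, rfl, rfl⟩, rfl, rfl⟩
  · rintro ⟨i, _, _, ⟨w, a, b, hab, rfl, rfl⟩, rfl, rfl⟩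
    refine ⟨Fin.cons i w, a, b, ?_, rfl, rfl⟩
    rwa [restrict_cons _ rfl]

theorem part_trace (f : SimpleGraph (VG (n + 1 + 1))) (i : Fin 3) :
    part i (trace f) = trace (part i f) := by
  rw [trace_succ, part_glue]

theorem trace_le (f : SimpleGraph (VG (n + 1))) : trace f ≤ G n := by
  induction n with
  | zero => exact G_zero ▸ le_top
  | succ n ih =>
    rw [trace_succ]
    exact glue_le fun i => ih _

/-- True by construction on G_1, and inherited upwards because the pattern of a forest depends only
on the patterns of its parts. -/
theorem IsPat.trace {f : SimpleGraph (VG (n + 1))} {q : Pat} (hf : IsPat f q) :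
    IsPat (trace f) q := by
  induction n generalizing q with
  | zero =>
    rw [trace_zero hf.le]
    exact isPat_traceOne hf
  | succ n ih =>
    obtain ⟨p, hp, hg⟩ := (isPat_succ_iff hf.le).1 hf
    refine (isPat_succ_iff (trace_le f)).2 ⟨p, fun i => ?_, hg⟩
    rw [part_trace]
    exact ih (hp i)

/-- For a target level above 0 the class is determined by the patterns in the cells, which the trace
keeps; for target level 0 the trace is defined by the class. -/
theorem trace_mem_TClass {f : SimpleGraph (VG (n + 1))} {i : Fin 3} (hf : f ∈ TClass (n + 1) i) :
    trace f ∈ TClass n i := by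
  have hT := isPat_of_mem_TClass hf
  cases n with
  | zero =>
    rw [trace_zero hT.le]
    exact traceOne_of_mem_TClass hf
  | succ n =>
    obtain ⟨p, hp, hg⟩ := (isPat_succ_iff hT.le).1 hT
    rw [mem_TClass_succ_iff_TGlue hT hp] at hf
    refine (mem_TClass_succ_iff_TGlue hT.trace (p := p) fun i => ?_).2 hf
    rw [part_trace]
    exact (hp i).trace

/-- The tree `f` lies in some class, the trace keeps that class, and the classes at level `n` are
disjoint. -/
theorem mem_TClass_of_trace {f : SimpleGraph (VG (n + 1))} {q : Pat} (hf : IsPat f q) {i : Fin 3}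
    (h : trace f ∈ TClass n i) : f ∈ TClass (n + 1) i := by
  obtain rfl := hf.trace.unique (isPat_of_mem_TClass h)
  obtain ⟨j, hj, -⟩ := existsUnique_mem_TClass hf
  rwa [(existsUnique_mem_TClass hf.trace).unique h (trace_mem_TClass hj)]

/-! ### Counting -/

theorem ncard_parts (A : Fin 3 → Set (SimpleGraph (VG n))) (hA : ∀ i, ∀ h ∈ A i, h ≤ G n) :
    {f : SimpleGraph (VG (n + 1)) | f ≤ G (n + 1) ∧ ∀ i, part i f ∈ A i}.ncard =
      ∏ i, (A i).ncard := by
  simp only [← Nat.card_coe_set_eq]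
  rw [← Nat.card_pi]
  refine Nat.card_congr
    { toFun := fun f i => ⟨part i f.1, f.2.2 i⟩
      invFun := fun h => ⟨glue fun i => (h i).1, glue_le fun i => hA i _ (h i).2,
        fun i => (part_glue (fun i => (h i).1) i).symm ▸ (h i).2⟩
      left_inv := fun f => Subtype.ext (glue_part f.2.1)
      right_inv := fun h => funext fun i => Subtype.ext (part_glue _ i) }

/-- The number of spanning forests of the triangle with a given pattern. -/
def Pat.weight : Pat → ℕ
  | .T => 3
  | .S _ => 1
  | .R => 1

theorem ncard_isPat_zero (p : Pat) :
    {H : SimpleGraph (VG 0) | IsPat H p}.ncard = p.weight := by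
  cases p with
  | T =>
    have : {H : SimpleGraph (VG 0) | IsPat H .T} = cherry '' Set.univ := by
      ext H
      rw [Set.image_univ]
      constructor
      · exact fun h => (isPat_zero_T h).imp fun i hi => hi.symm
      · rintro ⟨i, rfl⟩
        exact isPat_cherry i
    rw [this, Set.ncard_image_of_injective _ cherry_injective, Set.ncard_univ,
      Nat.card_eq_fintype_card, Fintype.card_fin]
    rfl
  | S i =>
    have : {H : SimpleGraph (VG 0) | IsPat H (.S i)} = {opposite i} := by
      ext H
      exact ⟨fun h => isPat_zero_S h, fun h => h ▸ isPat_opposite i⟩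
    rw [this, Set.ncard_singleton]
    rfl
  | R =>
    have : {H : SimpleGraph (VG 0) | IsPat H .R} = {⊥} := by
      ext H
      exact ⟨fun h => isPat_zero_R h, fun h => h ▸ isPat_bot⟩
    rw [this, Set.ncard_singleton]
    rfl

/-- A subgraph determines the patterns of its parts, so the set splits according to `p`, and each
piece is a product over the cells. -/
theorem ncard_parts_pattern (Φ : (Fin 3 → Pat) → Prop) [DecidablePred Φ] :
    {f : SimpleGraph (VG 1) | f ≤ G 1 ∧
      ∃ p : Fin 3 → Pat, (∀ i, IsPat (part i f) (p i)) ∧ Φ p}.ncard =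
      ∑ p : Fin 3 → Pat, if Φ p then ∏ i, (p i).weight else 0 := by
  have h1 : ∀ p : Fin 3 → Pat,
      {f : SimpleGraph (VG 1) | f ≤ G 1 ∧ ∀ i, IsPat (part i f) (p i)}.ncard =
        ∏ i, (p i).weight := fun p => by
    simp only [← ncard_isPat_zero]
    exact ncard_parts (fun i => {H | IsPat H (p i)}) fun i h hh => hh.le
  rw [← Finset.sum_filter, Finset.sum_subtype (p := Φ) _ (by simp)]
  simp only [← h1, ← Nat.card_coe_set_eq]
  rw [← Nat.card_sigma]
  symm
  refine Nat.card_congr (Equiv.ofBijective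
    (fun x : Σ p : {p // Φ p},
        {f : SimpleGraph (VG 1) | f ≤ G 1 ∧ ∀ i, IsPat (part i f) (p.1 i)} =>
      (⟨x.2.1, x.2.2.1, x.1.1, x.2.2.2, x.1.2⟩ : {f : SimpleGraph (VG 1) | f ≤ G 1 ∧
        ∃ p : Fin 3 → Pat, (∀ i, IsPat (part i f) (p i)) ∧ Φ p})) ⟨?_, ?_⟩)
  · rintro ⟨⟨p, hp⟩, f, hf, hfp⟩ ⟨⟨q, hq⟩, g, hg, hgq⟩ h
    obtain rfl : f = g := congrArg Subtype.val h
    obtain rfl : p = q := funext fun i => (hfp i).unique (hgq i)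
    rfl
  · rintro ⟨f, hf, p, hfp, hp⟩
    exact ⟨⟨⟨p, hp⟩, f, hf, hfp⟩, rfl⟩

/-- The three sums 18, 30, 50 have the common ratio 5/3, the numerical fact on which the constancy
of the fibres rests. Here, for a fixed middle cell, there are two chains of weight 3 · 3 · 1. -/
theorem sum_weight_T : ∀ i, (∑ p : Fin 3 → Pat,
    if Glue p .T ∧ TGlue i p then ∏ i, (p i).weight else 0) = 18 := by
  decide +kernel

theorem sum_weight_S : ∀ i, (∑ p : Fin 3 → Pat,
    if Glue p (.S i) then ∏ i, (p i).weight else 0) = 30 := by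
  decide +kernel

theorem sum_weight_R : (∑ p : Fin 3 → Pat,
    if Glue p .R then ∏ i, (p i).weight else 0) = 50 := by
  decide +kernel

/-! ### Fibres of the trace -/

/-- The fibre of the trace over `g` in the set `QClass (n + 1)`. -/
def fibre (g : SimpleGraph (VG n)) : Set (SimpleGraph (VG (n + 1))) :=
  {f | f ∈ QClass (n + 1) ∧ trace f = g}

theorem mem_fibre_iff {g : SimpleGraph (VG n)} {q : Pat} (hg : IsPat g q)
    {f : SimpleGraph (VG (n + 1))} : f ∈ fibre g ↔ IsPat f q ∧ trace f = g := by
  rw [fibre, Set.mem_ofPred_eq, mem_QClass_iff]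
  refine and_congr_left fun h => ⟨?_, fun h => ⟨q, h⟩⟩
  rintro ⟨p, hp⟩
  subst h
  rwa [← hp.trace.unique hg]

theorem fibre_of_mem_TClass {g : SimpleGraph (VG n)} {i : Fin 3} (hg : g ∈ TClass n i) :
    fibre g = {f | f ∈ TClass (n + 1) i ∧ trace f = g} := by
  ext f
  rw [mem_fibre_iff (isPat_of_mem_TClass hg)]
  refine and_congr_left fun h => ⟨fun hf => mem_TClass_of_trace hf (h ▸ hg), isPat_of_mem_TClass⟩

theorem ncard_TClass_one (i : Fin 3) : (TClass 1 i).ncard = 18 := by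
  rw [← sum_weight_T i, ← ncard_parts_pattern]
  congr 1
  ext f
  constructor
  · intro h
    have hT := isPat_of_mem_TClass h
    obtain ⟨p, hp, hg⟩ := (isPat_succ_iff hT.le).1 hT
    exact ⟨hT.le, p, hp, hg, (mem_TClass_succ_iff_TGlue hT hp).1 h⟩
  · rintro ⟨hf, p, hp, hg, ht⟩
    exact (mem_TClass_succ_iff_TGlue ((isPat_succ_iff hf).2 ⟨p, hp, hg⟩) hp).2 ht

theorem ncard_isPat_one (q : Pat) : {f : SimpleGraph (VG 1) | IsPat f q}.ncard =
    ∑ p : Fin 3 → Pat, if Glue p q then ∏ i, (p i).weight else 0 := by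
  rw [← ncard_parts_pattern]
  congr 1
  ext f
  exact ⟨fun h => ⟨h.le, (isPat_succ_iff h.le).1 h⟩, fun h => (isPat_succ_iff h.1).2 h.2⟩

/-- The fibre over a forest `g` of pattern `q` has `fibreConst n * (5 / 3) ^ q.ncl` elements. -/
def fibreConst : ℕ → ℚ
  -- Chosen so that multiplication by (5/3)^k yields 18, 30, 50 for k = 1, 2, 3.
  | 0 => 54 / 5
  | n + 1 => (fibreConst n * (5 / 3)) ^ 3

/-- Induction on the level: the fibre is the product of the fibres over the parts, and the class
equation in `Glue` turns the product of the three powers of 5/3 into one depending only on `q`. -/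
theorem ncard_fibre {g : SimpleGraph (VG n)} {q : Pat} (hg : IsPat g q) :
    ((fibre g).ncard : ℚ) = fibreConst n * (5 / 3) ^ q.ncl := by
  induction n generalizing q with
  | zero =>
    cases q with
    | T =>
      obtain ⟨i, rfl⟩ := isPat_zero_T hg
      have : fibre (cherry i) = TClass 1 i := by
        rw [fibre_of_mem_TClass (i := i) rfl]
        ext f
        exact and_iff_left_of_imp fun h => trace_mem_TClass h
      rw [this, ncard_TClass_one]
      norm_num [fibreConst, Pat.ncl]
    | S i =>
      have : fibre g = {f | IsPat f (.S i)} := by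
        ext f
        rw [mem_fibre_iff hg]
        refine and_iff_left_of_imp fun h => ?_
        rw [isPat_zero_S h.trace, isPat_zero_S hg]
      rw [this, ncard_isPat_one, sum_weight_S]
      norm_num [fibreConst, Pat.ncl]
    | R =>
      have : fibre g = {f | IsPat f .R} := by
        ext f
        rw [mem_fibre_iff hg]
        refine and_iff_left_of_imp fun h => ?_
        rw [isPat_zero_R h.trace, isPat_zero_R hg]
      rw [this, ncard_isPat_one, sum_weight_R]
      norm_num [fibreConst, Pat.ncl]
  | succ n ih =>
    obtain ⟨p, hp, hpq⟩ := (isPat_succ_iff hg.le).1 hg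
    -- Each part of `f` has the pattern of the corresponding part of `g`, so the same gluing
    -- relation yields pattern `q` for both.
    have : fibre g = {f | f ≤ G (n + 1 + 1) ∧ ∀ i, part i f ∈ fibre (part i g)} := by
      ext f
      simp only [mem_fibre_iff hg, Set.mem_ofPred_eq, mem_fibre_iff (hp _)]
      constructor
      · rintro ⟨hf, rfl⟩
        refine ⟨hf.le, fun i => ⟨?_, (part_trace f i).symm⟩⟩
        obtain ⟨p', hp', -⟩ := (isPat_succ_iff hf.le).1 hf
        have := (hp' i).trace
        rw [← part_trace] at this
        rw [(hp i).unique this]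
        exact hp' i
      · rintro ⟨hf, h⟩
        refine ⟨(isPat_succ_iff hf).2 ⟨p, fun i => (h i).1, hpq⟩,
          ext_of_part_eq (trace_le f) hg.le fun i => ?_⟩
        rw [part_trace, (h i).2]
    rw [this, ncard_parts _ fun i h hh => ((mem_fibre_iff (hp i)).1 hh).1.le]
    push_cast
    simp only [ih (hp _), Finset.prod_mul_distrib, Finset.prod_pow_eq_pow_sum]
    -- The exponents add up to `q.ncl + 3`; the surplus (5/3)^3 is absorbed by the constant of the
    -- next level.
    rw [← hpq.2.2, pow_add, fibreConst]
    simp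
    ring

theorem fibreConst_pos (n : ℕ) : 0 < fibreConst n := by
  induction n with
  | zero => norm_num [fibreConst]
  | succ n ih => rw [fibreConst]; positivity

/-! ### Uniform distributions and projective limits -/

section Uniform

theorem ncard_eq_mul_of_fibres {α β : Type*} [Finite α] {A : Set α} {B : Set β} {t : α → β}
    {k : ℕ}
    (hB : B.Finite) (hmaps : Set.MapsTo t A B)
    (hk : ∀ b ∈ B, {a | a ∈ A ∧ t a = b}.ncard = k) : A.ncard = B.ncard * k := by
  classical
  have := Fintype.ofFinite α
  have h := Finset.card_eq_sum_card_fiberwise (f := t) (s := A.toFinset) (t := hB.toFinset)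
    (by simpa using hmaps)
  rw [Set.ncard_eq_toFinset_card' A, h, Set.ncard_eq_toFinset_card B hB, ← smul_eq_mul]
  refine Finset.sum_eq_card_nsmul fun b hb => ?_
  rw [← hk b (by simpa using hb), Set.ncard_eq_toFinset_card']
  congr 1
  ext a
  simp

variable {α β : Type*} [MeasurableSpace α] [MeasurableSpace β]

theorem uniformOn_eq_ncard_div [Finite α] [DiscreteMeasurableSpace α] (A s : Set α) :
    uniformOn A s = (A ∩ s).ncard / A.ncard := by
  classical
  have := Fintype.ofFinite α
  have h := uniformOn_apply_finset (s := A.toFinset) (t := s.toFinset)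
  rw [← Set.toFinset_inter, Set.coe_toFinset, Set.coe_toFinset] at h
  rw [h, Set.ncard_eq_toFinset_card', Set.ncard_eq_toFinset_card']

theorem uniformOn_singleton_of_mem [Finite α] [DiscreteMeasurableSpace α] {A : Set α} {a : α}
    (ha : a ∈ A) : uniformOn A {a} = (A.ncard : ENNReal)⁻¹ := by
  rw [uniformOn_eq_ncard_div, Set.inter_eq_right.2 (Set.singleton_subset_iff.2 ha),
    Set.ncard_singleton, Nat.cast_one, one_div]

theorem uniformOn_singleton_of_notMem [Finite α] [DiscreteMeasurableSpace α] {A : Set α} {a : α}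
    (ha : a ∉ A) : uniformOn A {a} = 0 := by
  rw [uniformOn_eq_ncard_div, Set.inter_singleton_eq_empty.2 ha, Set.ncard_empty, Nat.cast_zero,
    ENNReal.zero_div]

/-- The kernel that chooses uniformly an element of `A` in the fibre of `t`. -/
def fibreKernel [DiscreteMeasurableSpace β] [Countable β] (A : Set α) (B : Set β) (t : α → β) :
    Kernel β α :=
  open scoped Classical in
  Kernel.ofFunOfCountable fun b =>
    -- The value off `B` is irrelevant; `uniformOn A` merely keeps the kernel Markov.
    if b ∈ B then uniformOn {a | a ∈ A ∧ t a = b} else uniformOn A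

theorem fibreKernel_apply [DiscreteMeasurableSpace β] [Countable β] {A : Set α} {B : Set β}
    {t : α → β} {b : β} (hb : b ∈ B) :
    fibreKernel A B t b = uniformOn {a | a ∈ A ∧ t a = b} := by
  classical
  exact if_pos hb

variable [Finite α] [DiscreteMeasurableSpace α] [Finite β] [DiscreteMeasurableSpace β]
  {A : Set α} {B : Set β} {t : α → β} {k : ℕ}

theorem isMarkovKernel_fibreKernel (hA : A.Nonempty)
    (hk : ∀ b ∈ B, {a | a ∈ A ∧ t a = b}.ncard = k) (hk0 : 0 < k) :
    IsMarkovKernel (fibreKernel A B t) := by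
  classical
  refine ⟨fun b => ?_⟩
  by_cases hb : b ∈ B
  · rw [fibreKernel_apply hb]
    refine isProbabilityMeasure_uniformOn (Set.toFinite _) (Set.nonempty_of_ncard_ne_zero ?_)
    rw [hk b hb]
    exact hk0.ne'
  · have : fibreKernel A B t b = uniformOn A := if_neg hb
    rw [this]
    exact isProbabilityMeasure_uniformOn (Set.toFinite _) hA

/-- A uniform point of `B` followed by a uniform point of its fibre gives each `a ∈ A` mass 1 / (|B|
k) = 1 / |A|. -/
theorem uniformOn_compProd_fibreKernel (hA : A.Nonempty) (hmaps : Set.MapsTo t A B)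
    (hk : ∀ b ∈ B, {a | a ∈ A ∧ t a = b}.ncard = k) (hk0 : 0 < k) :
    uniformOn B ⊗ₘ fibreKernel A B t = (uniformOn A).map fun a => (t a, a) := by
  have := isMarkovKernel_fibreKernel hA hk hk0
  refine Measure.ext_of_singleton fun ⟨b, a⟩ => ?_
  rw [← Set.singleton_prod_singleton, Measure.compProd_apply_prod (.of_discrete) (.of_discrete),
    lintegral_singleton, Measure.map_apply .of_discrete .of_discrete]
  have hpre : (fun a => (t a, a)) ⁻¹' {b} ×ˢ {a} = {x | x = a ∧ t a = b} := by
    ext x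
    simp only [Set.mem_preimage, Set.mem_prod, Set.mem_singleton_iff, Set.mem_ofPred_eq]
    constructor
    · rintro ⟨h, rfl⟩
      exact ⟨rfl, h⟩
    · rintro ⟨rfl, h⟩
      exact ⟨h, rfl⟩
  rw [hpre]
  by_cases h : a ∈ A ∧ t a = b
  · obtain ⟨ha, rfl⟩ := h
    have hb := hmaps ha
    have hs : {x | x = a ∧ t a = t a} = {a} := by ext; simp
    rw [hs, fibreKernel_apply hb, uniformOn_singleton_of_mem hb, uniformOn_singleton_of_mem ha,
      uniformOn_singleton_of_mem (show a ∈ {x | x ∈ A ∧ t x = t a} from ⟨ha, rfl⟩), hk _ hb,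
      ncard_eq_mul_of_fibres (Set.toFinite B) hmaps hk, Nat.cast_mul, mul_comm,
      ENNReal.mul_inv (.inr (ENNReal.natCast_ne_top _)) (.inl (ENNReal.natCast_ne_top _))]
  · have hz : uniformOn A {x | x = a ∧ t a = b} = 0 := by
      have : A ∩ {x | x = a ∧ t a = b} = ∅ := by
        ext x
        simp only [Set.mem_inter_iff, Set.mem_ofPred_eq, Set.mem_empty_iff_false, iff_false]
        rintro ⟨hx, rfl, hxb⟩
        exact h ⟨hx, hxb⟩
      rw [uniformOn_eq_ncard_div, this]
      simp
    rw [hz]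
    by_cases hb : b ∈ B
    · rw [fibreKernel_apply hb, uniformOn_singleton_of_notMem (A := {x | x ∈ A ∧ t x = b}) h,
        zero_mul]
    · rw [uniformOn_singleton_of_notMem hb, mul_zero]

theorem map_uniformOn_of_fibres (hA : A.Nonempty) (hmaps : Set.MapsTo t A B)
    (hk : ∀ b ∈ B, {a | a ∈ A ∧ t a = b}.ncard = k) (hk0 : 0 < k) :
    (uniformOn A).map t = uniformOn B := by
  have := isMarkovKernel_fibreKernel hA hk hk0
  rw [← Measure.fst_compProd (uniformOn B) (fibreKernel A B t),
    uniformOn_compProd_fibreKernel hA hmaps hk hk0, Measure.fst,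
    Measure.map_map .of_discrete .of_discrete]
  rfl

end Uniform

/-! ### Markov chains of uniform preimages -/

section Limit

variable {X : ℕ → Type*} [∀ n, MeasurableSpace (X n)]

theorem map_eval_zero_trajMeasure (μ₀ : Measure (X 0)) [IsProbabilityMeasure μ₀]
    (κ : (n : ℕ) → Kernel (Π i : Finset.Iic n, X i) (X (n + 1))) [∀ n, IsMarkovKernel (κ n)] :
    (Kernel.trajMeasure μ₀ κ).map (fun x => x 0) = μ₀ := by
  let e := MeasurableEquiv.piUnique fun i : Finset.Iic 0 => X i
  have h1 := Measure.map_map (μ := Kernel.trajMeasure μ₀ κ) e.measurable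
    (Preorder.measurable_frestrictLe 0)
  have h2 : (Kernel.trajMeasure μ₀ κ).map (Preorder.frestrictLe 0) = μ₀.map e.symm := by
    rw [Kernel.trajMeasure, Measure.map_comp _ _ (by fun_prop), Kernel.traj_map_frestrictLe,
      Kernel.partialTraj_self, Measure.id_comp]
  rw [h2] at h1
  exact h1.symm.trans e.map_map_symm

variable [∀ n, Finite (X n)] [∀ n, DiscreteMeasurableSpace (X n)]

/-- The Markov property: each step kernel sees only the last coordinate of the history, so the
general disintegration over the history reduces to one over that coordinate. -/
theorem map_pair_trajMeasure (μ₀ : Measure (X 0)) [IsProbabilityMeasure μ₀]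
    (K : (n : ℕ) → Kernel (X n) (X (n + 1))) [∀ n, IsMarkovKernel (K n)] (n : ℕ) :
    (Kernel.trajMeasure μ₀ fun n => (K n).comap
        (fun h : Π i : Finset.Iic n, X i => h ⟨n, Finset.mem_Iic.2 le_rfl⟩) (by fun_prop)).map
      (fun x => (x n, x (n + 1))) =
    ((Kernel.trajMeasure μ₀ fun n => (K n).comap
        (fun h : Π i : Finset.Iic n, X i => h ⟨n, Finset.mem_Iic.2 le_rfl⟩) (by fun_prop)).map
      (fun x => x n)) ⊗ₘ K n := by
  set κ : (n : ℕ) → Kernel (Π i : Finset.Iic n, X i) (X (n + 1)) := fun n => (K n).comap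
    (fun h : Π i : Finset.Iic n, X i => h ⟨n, Finset.mem_Iic.2 le_rfl⟩) (by fun_prop)
  set μ := Kernel.trajMeasure μ₀ κ
  have hp : IsProbabilityMeasure (μ.map fun x => x n) :=
    Measure.isProbabilityMeasure_map (measurable_pi_apply n).aemeasurable
  have hp' : IsProbabilityMeasure (μ.map (Preorder.frestrictLe n)) :=
    Measure.isProbabilityMeasure_map (by fun_prop)
  have h := Kernel.map_frestrictLe_trajMeasure_compProd_eq_map_trajMeasure (μ₀ := μ₀) (κ := κ)
    (a := n)
  refine Measure.ext_of_singleton fun ⟨b, a⟩ => ?_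
  have hev : Measurable fun h : Π i : Finset.Iic n, X i => h ⟨n, Finset.mem_Iic.2 le_rfl⟩ := by
    fun_prop
  have hb : MeasurableSet
      {h : Π i : Finset.Iic n, X i | h ⟨n, Finset.mem_Iic.2 le_rfl⟩ = b} :=
    hev (MeasurableSet.of_discrete (s := {b}))
  have h1 := congrArg (fun ν => ν ({h : Π i : Finset.Iic n, X i |
    h ⟨n, Finset.mem_Iic.2 le_rfl⟩ = b} ×ˢ {a})) h
  dsimp only at h1
  rw [Measure.map_apply (by fun_prop) (hb.prod .of_discrete),
    Measure.compProd_apply_prod hb .of_discrete, setLIntegral_congr_fun (g := fun _ => K n b {a})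
    hb (fun h hh => by rw [← show h ⟨n, _⟩ = b from hh]; rfl), setLIntegral_const,
    Measure.map_apply (by fun_prop) hb] at h1
  rw [← Set.singleton_prod_singleton, Measure.compProd_apply_prod .of_discrete .of_discrete,
    lintegral_singleton, Measure.map_apply (by fun_prop) .of_discrete,
    Measure.map_apply (by fun_prop) .of_discrete]
  exact h1.symm

/-- Along maps with fibres of constant size, the projective limit of finite sets carries a
probability measure with uniform marginals. -/
theorem exists_measure_projLim (A : ∀ n, Set (X n)) (t : ∀ n, X (n + 1) → X n) (k : ℕ → ℕ)
    (hA : ∀ n, (A n).Nonempty) (hmaps : ∀ n, Set.MapsTo (t n) (A (n + 1)) (A n))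
    (hk : ∀ n, ∀ b ∈ A n, {a | a ∈ A (n + 1) ∧ t n a = b}.ncard = k n) (hk0 : ∀ n, 0 < k n) :
    ∃ ν : Measure {x : Π n, X n | ∀ n, x n ∈ A n ∧ t n (x (n + 1)) = x n},
      IsProbabilityMeasure ν ∧ ∀ n, ν.map (fun x => x.1 n) = uniformOn (A n) := by
  set L := {x : Π n, X n | ∀ n, x n ∈ A n ∧ t n (x (n + 1)) = x n} with hL
  let K : (n : ℕ) → Kernel (X n) (X (n + 1)) := fun n => fibreKernel (A (n + 1)) (A n) (t n)
  have hK : ∀ n, IsMarkovKernel (K n) := fun n =>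
    isMarkovKernel_fibreKernel (hA _) (hk n) (hk0 n)
  have h0 : IsProbabilityMeasure (uniformOn (A 0)) :=
    isProbabilityMeasure_uniformOn (Set.toFinite _) (hA 0)
  -- By the Ionescu-Tulcea construction; only the initial law and the laws of consecutive pairs are
  -- needed below.
  obtain ⟨μ, hμ, hμ0, hpair⟩ : ∃ μ : Measure (Π n, X n), IsProbabilityMeasure μ ∧
      μ.map (fun x => x 0) = uniformOn (A 0) ∧
      ∀ n, μ.map (fun x => (x n, x (n + 1))) = (μ.map fun x => x n) ⊗ₘ K n :=
    ⟨_, inferInstance, map_eval_zero_trajMeasure _ _, map_pair_trajMeasure (uniformOn (A 0)) K⟩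
  have hcomp : ∀ n, uniformOn (A n) ⊗ₘ K n = (uniformOn (A (n + 1))).map fun a => (t n a, a) :=
    fun n => uniformOn_compProd_fibreKernel (hA _) (hmaps n) (hk n) (hk0 n)
  have hmarg : ∀ n, μ.map (fun x => x n) = uniformOn (A n) := by
    intro n
    induction n with
    | zero => exact hμ0
    | succ n ih =>
      have h : (fun x : Π n, X n => x (n + 1)) = Prod.snd ∘ fun x => (x n, x (n + 1)) := rfl
      rw [h, ← Measure.map_map (by fun_prop) (by fun_prop), hpair, ih, hcomp,
        Measure.map_map (by fun_prop) .of_discrete]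
      exact Measure.map_id
  have hLm : MeasurableSet L := by
    rw [hL, Set.ofPred_forall]
    refine MeasurableSet.iInter fun n => ?_
    have h1 : Measurable fun x : Π n, X n => x n := by fun_prop
    have h2 : Measurable fun x : Π n, X n => t n (x (n + 1)) :=
      (Measurable.of_discrete (f := t n)).comp (by fun_prop)
    exact (h1 (MeasurableSet.of_discrete (s := A n))).inter (measurableSet_eq_fun h2 h1)
  -- Each of the countably many conditions involves one coordinate or two consecutive ones, whose
  -- laws are now known.
  have hae : ∀ᵐ x ∂μ, x ∈ L := by
    rw [hL]
    simp only [Set.mem_ofPred_eq, ae_all_iff]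
    intro n
    have h1 : ∀ᵐ y ∂(μ.map fun x => x n), y ∈ A n := by
      rw [hmarg, ae_iff]
      change uniformOn (A n) (A n)ᶜ = 0
      rw [uniformOn_eq_ncard_div, Set.inter_compl_self]
      simp
    have h2 : ∀ᵐ y ∂(μ.map fun x => (x n, x (n + 1))), t n y.2 = y.1 := by
      rw [hpair, hmarg, hcomp, ae_map_iff Measurable.of_discrete.aemeasurable .of_discrete]
      exact ae_of_all _ fun _ => rfl
    rw [ae_map_iff (measurable_pi_apply n).aemeasurable .of_discrete] at h1
    rw [ae_map_iff (by fun_prop) .of_discrete] at h2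
    filter_upwards [h1, h2] with x hx1 hx2 using ⟨hx1, hx2⟩
  -- Since `μ` is concentrated on `L`, restricting it to the subtype loses no mass and keeps the
  -- marginals.
  have hmap : (μ.comap ((↑) : L → Π n, X n)).map (↑) = μ := by
    rw [map_comap_subtype_coe hLm, Measure.restrict_eq_self_of_ae_mem hae]
  refine ⟨μ.comap (↑), ⟨?_⟩, fun n => ?_⟩
  · rw [comap_subtype_coe_apply hLm, Set.image_univ, Subtype.range_coe]
    exact (mem_ae_iff_prob_eq_one hLm).1 hae
  · rw [← hmarg n]
    conv_rhs => rw [← hmap]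
    rw [Measure.map_map (by fun_prop) measurable_subtype_coe]
    rfl

end Limit

/-! ### The classes as inverse systems -/

instance (n : ℕ) : DiscreteMeasurableSpace (SimpleGraph (VG n)) := ⟨fun _ => trivial⟩

theorem exists_ncard_fibre (n : ℕ) (q : Pat) :
    ∃ k : ℕ, 0 < k ∧ ∀ g : SimpleGraph (VG n), IsPat g q → (fibre g).ncard = k := by
  by_cases h : ∃ g : SimpleGraph (VG n), IsPat g q
  · obtain ⟨g, hg⟩ := h
    refine ⟨(fibre g).ncard, ?_, fun g' hg' => ?_⟩
    · have := fibreConst_pos n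
      rw [← Nat.cast_pos (α := ℚ), ncard_fibre hg]
      positivity
    · rw [← Nat.cast_inj (R := ℚ), ncard_fibre hg, ncard_fibre hg']
  · exact ⟨1, one_pos, fun g hg => absurd ⟨g, hg⟩ h⟩

/-- The size of the fibres of the trace over forests of pattern `q`. -/
def fibreCard (n : ℕ) (q : Pat) : ℕ := (exists_ncard_fibre n q).choose

theorem fibreCard_pos (n : ℕ) (q : Pat) : 0 < fibreCard n q :=
  (exists_ncard_fibre n q).choose_spec.1

theorem ncard_fibre_eq {n : ℕ} {g : SimpleGraph (VG n)} {q : Pat} (hg : IsPat g q) :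
    (fibre g).ncard = fibreCard n q := (exists_ncard_fibre n q).choose_spec.2 g hg

/-- Families of sets of forests of pattern `q`, consisting of one element at level `0`, and of the
preimages of this element under the iterated trace at the other levels. -/
structure TraceClass (A : (n : ℕ) → Set (SimpleGraph (VG n))) (q : Pat) : Prop where
  isPat : ∀ n, ∀ g ∈ A n, IsPat g q
  mapsTo : ∀ n, Set.MapsTo trace (A (n + 1)) (A n)
  mem_of_trace : ∀ n, ∀ f, IsPat f q → trace f ∈ A n → f ∈ A (n + 1)
  ncard_zero : (A 0).ncard = 1

theorem traceClass_TClass (i : Fin 3) : TraceClass (fun n => TClass n i) .T where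
  isPat _ _ := isPat_of_mem_TClass
  mapsTo _ _ := trace_mem_TClass
  mem_of_trace _ _ hf h := mem_TClass_of_trace hf h
  ncard_zero := Set.ncard_singleton _

theorem traceClass_SClass (i : Fin 3) : TraceClass (fun n => SClass n i) (.S i) where
  isPat _ _ := mem_SClass_iff.1
  mapsTo _ _ h := mem_SClass_iff.2 (mem_SClass_iff.1 h).trace
  mem_of_trace _ _ h _ := mem_SClass_iff.2 h
  ncard_zero := by
    have h := ncard_isPat_zero (.S i)
    simp only [← mem_SClass_iff] at h
    exact h

theorem traceClass_RClass : TraceClass RClass .R where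
  isPat _ _ := mem_RClass_iff.1
  mapsTo _ _ h := mem_RClass_iff.2 (mem_RClass_iff.1 h).trace
  mem_of_trace _ _ h _ := mem_RClass_iff.2 h
  ncard_zero := by
    have h := ncard_isPat_zero .R
    simp only [← mem_RClass_iff] at h
    exact h

/-! ### Inverse systems of forests of one pattern -/

namespace TraceClass

variable {A B : (n : ℕ) → Set (SimpleGraph (VG n))} {q : Pat}

theorem fibre_eq (h : TraceClass A q) {g : SimpleGraph (VG n)} (hg : g ∈ A n) :
    {f | f ∈ A (n + 1) ∧ trace f = g} = fibre g := by
  ext f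
  rw [mem_fibre_iff (h.isPat n g hg)]
  exact and_congr_left fun hf =>
    ⟨fun h' => h.isPat _ f h', fun h' => h.mem_of_trace n f h' (hf ▸ hg)⟩

theorem ncard_fibre (h : TraceClass A q) (n : ℕ) : ∀ g ∈ A n,
    {f | f ∈ A (n + 1) ∧ trace f = g}.ncard = fibreCard n q := fun g hg => by
  rw [h.fibre_eq hg, ncard_fibre_eq (h.isPat n g hg)]

theorem ncard_succ (h : TraceClass A q) (n : ℕ) :
    (A (n + 1)).ncard = (A n).ncard * fibreCard n q :=
  ncard_eq_mul_of_fibres (Set.toFinite _) (h.mapsTo n) (h.ncard_fibre n)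

theorem ncard_pos (h : TraceClass A q) (n : ℕ) : 0 < (A n).ncard := by
  induction n with
  | zero => rw [h.ncard_zero]; exact one_pos
  | succ n ih => rw [h.ncard_succ]; exact Nat.mul_pos ih (fibreCard_pos n q)

theorem nonempty (h : TraceClass A q) (n : ℕ) : (A n).Nonempty :=
  Set.nonempty_of_ncard_ne_zero (h.ncard_pos n).ne'

theorem fibre_ratio (h : TraceClass A q) {g : SimpleGraph (VG n)} (hg : g ∈ A n) :
    ((fibre g).ncard : ℚ) = ((A (n + 1)).ncard : ℚ) / (A n).ncard := by
  have h0 : ((A n).ncard : ℚ) ≠ 0 := Nat.cast_ne_zero.2 (h.ncard_pos n).ne'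
  rw [eq_div_iff h0, h.ncard_succ, ncard_fibre_eq (h.isPat n g hg), Nat.cast_mul, mul_comm]

theorem map_uniformOn (h : TraceClass A q) (n : ℕ) :
    (uniformOn (A (n + 1))).map trace = uniformOn (A n) :=
  map_uniformOn_of_fibres (h.nonempty _) (h.mapsTo n) (h.ncard_fibre n) (fibreCard_pos n q)

theorem exists_measure (h : TraceClass A q) : ∃ ν : Measure (ProjLim A),
    IsProbabilityMeasure ν ∧ ∀ n, ν.map (fun x => x.1 n) = uniformOn (A n) :=
  exists_measure_projLim A (fun _ => trace) (fun n => fibreCard n q) h.nonempty h.mapsTo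
    h.ncard_fibre fun n => fibreCard_pos n q

end TraceClass

/-- No rotation is used: the three classes start with one element and grow by the same factors. -/
theorem ncard_TClass (n : ℕ) (i : Fin 3) : (TClass n i).ncard = tau n := by
  induction n with
  | zero => rw [tau, (traceClass_TClass i).ncard_zero, (traceClass_TClass 0).ncard_zero]
  | succ n ih =>
    rw [tau, (traceClass_TClass i).ncard_succ, (traceClass_TClass 0).ncard_succ, ih]
    rfl

/-- The size formula involves only the number of classes, which is 2 for every `S i`. -/
theorem fibreCard_S (n : ℕ) (i j : Fin 3) : fibreCard n (.S i) = fibreCard n (.S j) := by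
  obtain ⟨g, hg⟩ := (traceClass_SClass i).nonempty n
  obtain ⟨g', hg'⟩ := (traceClass_SClass j).nonempty n
  rw [mem_SClass_iff] at hg hg'
  rw [← ncard_fibre_eq hg, ← ncard_fibre_eq hg', ← Nat.cast_inj (R := ℚ), ncard_fibre hg,
    ncard_fibre hg']
  rfl

theorem ncard_SClass (n : ℕ) (i : Fin 3) : (SClass n i).ncard = sigma n := by
  induction n with
  | zero => rw [sigma, (traceClass_SClass i).ncard_zero, (traceClass_SClass 0).ncard_zero]
  | succ n ih =>
    rw [sigma, (traceClass_SClass i).ncard_succ, (traceClass_SClass 0).ncard_succ, ih,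
      fibreCard_S n i 0]
    rfl

/-- A uniform tree in a uniformly chosen class is a uniform spanning tree. -/
theorem sum_uniformOn_TClass (n : ℕ) (s : Set (SimpleGraph (VG n))) :
    ∑ i : Fin 3, (3 : ENNReal)⁻¹ * uniformOn (TClass n i) s = uniformOn (Trees n) s := by
  have hsum : ∀ s : Set (SimpleGraph (VG n)),
      (Trees n ∩ s).ncard = ∑ i : Fin 3, (TClass n i ∩ s).ncard := fun s => by
    have hU : Trees n ∩ s = ⋃ i, TClass n i ∩ s := by
      ext t
      simp only [Set.mem_inter_iff, Set.mem_iUnion, mem_Trees_iff]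
      constructor
      · rintro ⟨ht, hs⟩
        obtain ⟨i, hi, -⟩ := existsUnique_mem_TClass ht
        exact ⟨i, hi, hs⟩
      · rintro ⟨i, hi, hs⟩
        exact ⟨isPat_of_mem_TClass hi, hs⟩
    rw [hU, Set.ncard_iUnion_of_finite (fun _ => Set.toFinite _), finsum_eq_sum_of_fintype]
    intro i j hij
    refine Set.disjoint_left.2 fun t hi hj => hij ?_
    exact (existsUnique_mem_TClass (isPat_of_mem_TClass hi.1)).unique hi.1 hj.1
  have h3 : (Trees n).ncard = 3 * tau n := by
    have := hsum Set.univ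
    simpa only [Set.inter_univ, ncard_TClass, Finset.sum_const, Finset.card_univ,
      Fintype.card_fin, smul_eq_mul] using this
  simp only [uniformOn_eq_ncard_div, ncard_TClass]
  rw [hsum, h3, Nat.cast_mul, Nat.cast_sum, div_eq_mul_inv, ENNReal.mul_inv (by simp) (by simp),
    Finset.sum_mul]
  refine Finset.sum_congr rfl fun i _ => ?_
  rw [div_eq_mul_inv, Nat.cast_ofNat]
  ring

/-! ### The joint probability space -/

section Joint

variable {PT : (i : Fin 3) → Measure (TLim i)} {PS : (i : Fin 3) → Measure (SLim i)}
  {PR : Measure RLim}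

theorem measurable_coord {A : (n : ℕ) → Set (SimpleGraph (VG n))} (n : ℕ) :
    Measurable fun x : ProjLim A => x.1 n :=
  (measurable_pi_apply n).comp measurable_subtype_coe

theorem measurable_TRand (i : Fin 3) (n : ℕ) : Measurable (TRand i n) :=
  (measurable_coord n).comp
    ((measurable_pi_apply i).comp (measurable_fst.comp measurable_snd))

variable [∀ i, IsProbabilityMeasure (PT i)] [∀ i, IsProbabilityMeasure (PS i)]
  [IsProbabilityMeasure PR]

instance : IsProbabilityMeasure (jointMeasure PT PS PR) := by
  unfold jointMeasure
  infer_instance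

theorem map_TRand {n : ℕ} {i : Fin 3}
    (h : (PT i).map (fun x => x.1 n) = uniformOn (TClass n i)) :
    (jointMeasure PT PS PR).map (TRand i n) = uniformOn (TClass n i) := by
  have h1 : MeasurePreserving (fun x : TLim i => x.1 n) (PT i) (uniformOn (TClass n i)) :=
    ⟨measurable_coord n, h⟩
  exact (h1.comp ((measurePreserving_eval PT i).comp
    (measurePreserving_fst.comp measurePreserving_snd))).map_eq

theorem map_SRand {n : ℕ} {i : Fin 3}
    (h : (PS i).map (fun x => x.1 n) = uniformOn (SClass n i)) :
    (jointMeasure PT PS PR).map (SRand i n) = uniformOn (SClass n i) := by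
  have h1 : MeasurePreserving (fun x : SLim i => x.1 n) (PS i) (uniformOn (SClass n i)) :=
    ⟨measurable_coord n, h⟩
  exact (h1.comp ((measurePreserving_eval PS i).comp
    (measurePreserving_fst.comp (measurePreserving_snd.comp measurePreserving_snd)))).map_eq

theorem map_RRand {n : ℕ} (h : PR.map (fun x => x.1 n) = uniformOn (RClass n)) :
    (jointMeasure PT PS PR).map (RRand n) = uniformOn (RClass n) := by
  have h1 : MeasurePreserving (fun x : RLim => x.1 n) PR (uniformOn (RClass n)) :=
    ⟨measurable_coord n, h⟩
  exact (h1.comp (measurePreserving_snd.comp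
    (measurePreserving_snd.comp measurePreserving_snd))).map_eq

theorem map_TreeRand {n : ℕ}
    (h : ∀ i, (PT i).map (fun x => x.1 n) = uniformOn (TClass n i)) :
    (jointMeasure PT PS PR).map (TreeRand n) = uniformOn (Trees n) := by
  have hm : Measurable (TreeRand n) := measurable_from_prod_countable_right fun i =>
    (measurable_TRand i n).comp measurable_prodMk_left
  ext s hs
  rw [Measure.map_apply hm hs, ← sum_uniformOn_TClass]
  have hj : jointMeasure PT PS PR = (uniformOn (Set.univ : Set (Fin 3))).prod
    ((Measure.pi PT).prod ((Measure.pi PS).prod PR)) := rfl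
  -- Fubini over the index: on the slice of index `i` the random tree is the one of class `i`, and
  -- the slice has weight 1/3.
  rw [hj, Measure.prod_apply (hm hs), lintegral_fintype]
  refine Finset.sum_congr rfl fun i _ => ?_
  have h1 : MeasurePreserving (fun x : TLim i => x.1 n) (PT i) (uniformOn (TClass n i)) :=
    ⟨measurable_coord n, h i⟩
  have h2 : MeasurePreserving _ ((Measure.pi PT).prod ((Measure.pi PS).prod PR)) _ :=
    h1.comp ((measurePreserving_eval PT i).comp measurePreserving_fst)
  rw [uniformOn_singleton_of_mem (Set.mem_univ i), Set.ncard_univ, Nat.card_eq_fintype_card,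
    Fintype.card_fin, mul_comm, ← h2.measure_preimage hs.nullMeasurableSet]
  rfl

end Joint

theorem traceIter_eq {A : (n : ℕ) → Set (SimpleGraph (VG n))} (x : ProjLim A) (n k : ℕ) :
    traceIter n k (x.1 (n + k)) = x.1 n := by
  induction k with
  | zero => rfl
  | succ k ih =>
    rw [traceIter]
    exact (congrArg (traceIter n k) (x.2 (n + k)).2).trans ih

end Sierpinski

end

/-! ### Assembly from the seven inverse systems -/

theorem mainTheorem10 :
    -- the counts do not depend on the index, and all classes are finite and non-empty
    (∀ n, 0 < tau n ∧ 0 < sigma n ∧ 0 < rho n) ∧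
    (∀ n i, (TClass n i).ncard = tau n ∧ (SClass n i).ncard = sigma n) ∧
    -- the trace respects the classes
    (∀ n, (∀ i, Set.MapsTo trace (TClass (n + 1) i) (TClass n i)) ∧
      (∀ i, Set.MapsTo trace (SClass (n + 1) i) (SClass n i)) ∧
      Set.MapsTo trace (RClass (n + 1)) (RClass n)) ∧
    -- the trace preserves the uniform distributions
    (∀ n, (∀ i, (uniformOn (TClass (n + 1) i)).map trace = uniformOn (TClass n i)) ∧
      (∀ i, (uniformOn (SClass (n + 1) i)).map trace = uniformOn (SClass n i)) ∧
      (uniformOn (RClass (n + 1))).map trace = uniformOn (RClass n)) ∧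
    -- the sizes of the fibres of the trace
    (∀ n,
      (∀ i, ∀ t ∈ TClass n i,
        ({f | f ∈ QClass (n + 1) ∧ trace f = t}.ncard : ℚ) = (tau (n + 1) : ℚ) / tau n) ∧
      (∀ i, ∀ s ∈ SClass n i,
        ({f | f ∈ QClass (n + 1) ∧ trace f = s}.ncard : ℚ) = (sigma (n + 1) : ℚ) / sigma n) ∧
      (∀ r ∈ RClass n,
        ({f | f ∈ QClass (n + 1) ∧ trace f = r}.ncard : ℚ) = (rho (n + 1) : ℚ) / rho n)) ∧
    -- the projective limits carry probability measures with uniform marginals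
    ∃ (PT : (i : Fin 3) → Measure (TLim i)) (PS : (i : Fin 3) → Measure (SLim i))
      (PR : Measure RLim),
      (∀ i, IsProbabilityMeasure (PT i)) ∧ (∀ i, IsProbabilityMeasure (PS i)) ∧
      IsProbabilityMeasure PR ∧
      (∀ n i, (PT i).map (fun x => x.1 n) = uniformOn (TClass n i)) ∧
      (∀ n i, (PS i).map (fun x => x.1 n) = uniformOn (SClass n i)) ∧
      (∀ n, PR.map (fun x => x.1 n) = uniformOn (RClass n)) ∧
      -- and their product with a uniform index is a joint probability space
      IsProbabilityMeasure (jointMeasure PT PS PR) ∧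
      (∀ n, (jointMeasure PT PS PR).map (TreeRand n) = uniformOn (Trees n)) ∧
      (∀ n i, (jointMeasure PT PS PR).map (TRand i n) = uniformOn (TClass n i)) ∧
      (∀ n i, (jointMeasure PT PS PR).map (SRand i n) = uniformOn (SClass n i)) ∧
      (∀ n, (jointMeasure PT PS PR).map (RRand n) = uniformOn (RClass n)) ∧
      (∀ (ω : Omega) (n k : ℕ),
        traceIter n k (TreeRand (n + k) ω) = TreeRand n ω ∧
        (∀ i, traceIter n k (TRand i (n + k) ω) = TRand i n ω) ∧
        (∀ i, traceIter n k (SRand i (n + k) ω) = SRand i n ω) ∧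
        traceIter n k (RRand (n + k) ω) = RRand n ω) := by
  choose PT hPT hPTm using fun i => (traceClass_TClass i).exists_measure
  choose PS hPS hPSm using fun i => (traceClass_SClass i).exists_measure
  obtain ⟨PR, hPR, hPRm⟩ := traceClass_RClass.exists_measure
  refine ⟨fun n => ⟨(traceClass_TClass 0).ncard_pos n, (traceClass_SClass 0).ncard_pos n,
    traceClass_RClass.ncard_pos n⟩, fun n i => ⟨ncard_TClass n i, ncard_SClass n i⟩,
    fun n => ⟨fun i => (traceClass_TClass i).mapsTo n, fun i => (traceClass_SClass i).mapsTo n,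
      traceClass_RClass.mapsTo n⟩,
    fun n => ⟨fun i => (traceClass_TClass i).map_uniformOn n,
      fun i => (traceClass_SClass i).map_uniformOn n, traceClass_RClass.map_uniformOn n⟩,
    fun n => ⟨fun i t ht => ?_, fun i s hs => ?_, fun r hr => traceClass_RClass.fibre_ratio hr⟩,
    PT, PS, PR, hPT, hPS, hPR, fun n i => hPTm i n, fun n i => hPSm i n, hPRm, inferInstance,
    fun n => map_TreeRand fun i => hPTm i n, fun n i => map_TRand (hPTm i n),
    fun n i => map_SRand (hPSm i n), fun n => map_RRand (hPRm n),
    fun ω n k => ⟨traceIter_eq (ω.2.1 ω.1) n k, fun i => traceIter_eq (ω.2.1 i) n k,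
      fun i => traceIter_eq (ω.2.2.1 i) n k, traceIter_eq ω.2.2.2 n k⟩⟩
  · rw [← ncard_TClass (n + 1) i, ← ncard_TClass n i]
    exact (traceClass_TClass i).fibre_ratio ht
  · rw [← ncard_SClass (n + 1) i, ← ncard_SClass n i]
    exact (traceClass_SClass i).fibre_ratio hs
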